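/- Let $n\in\mathbb N$, $n\ge 1$, $\beta\in(0,1]$, and $d\in\mathbb N$. For $f\in C^n(\mathbb R^d,\mathbb R^d)$ put $$\|f\|_{n,\beta}:=\max\Big\{\sup_{x\in\mathbb R^d,\,0\le l\le n}\|f^{(l)}(x)\|,\ \sup_{x\ne y}\frac{\|f^{(n)}(x)-f^{(n)}(y)\|}{\|x-y\|^\beta}\Big\},$$ where $f^{(l)}(x)$ is the $l$-th Fréchet derivative with its operator norm as an $l$-linear map. Let $C^{n,\beta}_0(\mathbb R^d,\mathbb R^d)$ be the normed space of all $f\in C^n(\mathbb R^d,\mathbb R^d)$ with $\|f\|_{n,\beta}<\infty$ such that $f^{(l)}(x)\to0$ as $\|x\|\to\infty$ for all $0\le l\le n$. Let $$\mathcal D^{n,\beta}(\mathbb R^d):=\{\Phi:\mathbb R^d\to\mathbb R^d\ :\ \Phi-\mathrm{Id}\in C^{n,\beta}_0(\mathbb R^d,\mathbb R^d),\ \det d\Phi(x)>0\ \text{for all }x\in\mathbb R^d\},$$ with the metric $(\Phi_1,\Phi_2)\mapsto\|\Phi_1-\Phi_2\|_{n,\beta}$. Then: 1. $\mathcal D^{n,\beta}(\mathbb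 R^d)$ is a group under composition: its unit is $\mathrm{Id}$, every $\Phi\in\mathcal D^{n,\beta}(\mathbb R^d)$ is a $C^n$-diffeomorphism of $\mathbb R^d$, and its group inverse is the inverse map $\Phi^{-1}$. 2. $\mathcal D^{n,\beta}(\mathbb R^d)-\mathrm{Id}$ is open in $C^{n,\beta}_0(\mathbb R^d,\mathbb R^d)$, and inversion is locally bounded in the chart $\Phi\mapsto\Phi-\mathrm{Id}$: for every $\Phi_0=\mathrm{Id}+\varphi_0\in\mathcal D^{n,\beta}(\mathbb R^d)$ there is $\delta>0$ such that the open ball $B(\varphi_0,\delta)$ of $C^{n,\beta}_0(\mathbb R^d,\mathbb R^d)$ is contained in $\mathcal D^{n,\beta}(\mathbb R^d)-\mathrm{Id}$ and $\{(\mathrm{Id}+\varphi)^{-1}-\mathrm{Id}:\varphi\in B(\varphi_0,\delta)\}$ is bounded in $C^{n,\beta}_0(\mathbb R^d,\mathbb R^d)$. 3. In general, left translations are discontinuous: if $d\ge1$, there is $\Psi\in\mathcal D^{n,\beta}(\mathbb R^d)$ such that the left translation $\Phi\mapsto\Psi\circ\Phi$ of $\mathcal D^{n,\beta}(\mathbb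 R^d)$ is not continuous. -/

import Mathlib

open scoped ENNReal

section Holder

variable {E F : Type*} [NormedAddCommGroup E] [NormedSpace ℝ E]
  [NormedAddCommGroup F] [NormedSpace ℝ F]

/-- `‖f‖_n`: the supremum of `‖f^(l) x‖` over all `x` and all `0 ≤ l ≤ n`, in `[0, ∞]`. -/
noncomputable def eCNorm (n : ℕ) (f : E → F) : ℝ≥0∞ :=
  ⨆ (x : E) (l : ℕ) (_ : l ≤ n), ‖iteratedFDeriv ℝ l f x‖ₑ

/-- `[f]_{n,β}`: the supremum of `‖f^(n) x - f^(n) y‖ / ‖x - y‖ ^ β` over `x ≠ y`,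
in `[0, ∞]`. -/
noncomputable def eHolderSeminorm (n : ℕ) (β : ℝ) (f : E → F) : ℝ≥0∞ :=
  ⨆ (x : E) (y : E) (_ : x ≠ y),
    ‖iteratedFDeriv ℝ n f x - iteratedFDeriv ℝ n f y‖ₑ / ‖x - y‖ₑ ^ β

/-- `‖f‖_{n,β} = max (‖f‖_n) ([f]_{n,β})`, in `[0, ∞]`. -/
noncomputable def eCHolderNorm (n : ℕ) (β : ℝ) (f : E → F) : ℝ≥0∞ :=
  max (eCNorm n f) (eHolderSeminorm n β f)

/-- `f` belongs to `C^{n,β}_b(E, F)`. -/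
def MemHolderB (n : ℕ) (β : ℝ) (f : E → F) : Prop :=
  ContDiff ℝ n f ∧ eCHolderNorm n β f < ∞

/-- `f` belongs to `C^{n,β}_0(E, F)`: it is in `C^{n,β}_b(E, F)` and tends to zero at infinity
together with all its derivatives up to order `n`. -/
def MemHolderZero (n : ℕ) (β : ℝ) (f : E → F) : Prop :=
  MemHolderB n β f ∧
    ∀ l ≤ n, Filter.Tendsto (fun x => iteratedFDeriv ℝ l f x) (Bornology.cobounded E) (nhds 0)

theorem enorm_iteratedFDeriv_le_eCHolderNorm {n : ℕ} (β : ℝ) (f : E → F) {l : ℕ} (hl : l ≤ n)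
    (x : E) : ‖iteratedFDeriv ℝ l f x‖ₑ ≤ eCHolderNorm n β f := by
  refine le_trans ?_ (le_max_left _ _)
  exact le_iSup_of_le x (le_iSup_of_le l (le_iSup_of_le hl le_rfl))

theorem enorm_div_le_eCHolderNorm (n : ℕ) (β : ℝ) (f : E → F) {x y : E} (hxy : x ≠ y) :
    ‖iteratedFDeriv ℝ n f x - iteratedFDeriv ℝ n f y‖ₑ / ‖x - y‖ₑ ^ β ≤ eCHolderNorm n β f := by
  refine le_trans ?_ (le_max_right _ _)
  exact le_iSup_of_le x (le_iSup_of_le y (le_iSup_of_le hxy le_rfl))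

theorem eCHolderNorm_le {n : ℕ} {β : ℝ} {f : E → F} {C : ℝ≥0∞}
    (h1 : ∀ x, ∀ l ≤ n, ‖iteratedFDeriv ℝ l f x‖ₑ ≤ C)
    (h2 : ∀ x y, x ≠ y →
      ‖iteratedFDeriv ℝ n f x - iteratedFDeriv ℝ n f y‖ₑ / ‖x - y‖ₑ ^ β ≤ C) :
    eCHolderNorm n β f ≤ C :=
  max_le (iSup_le fun x => iSup_le fun l => iSup_le fun hl => h1 x l hl)
    (iSup_le fun x => iSup_le fun y => iSup_le fun hxy => h2 x y hxy)

theorem eCHolderNorm_zero (n : ℕ) (β : ℝ) : eCHolderNorm n β (0 : E → F) = 0 := by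
  refine le_antisymm (eCHolderNorm_le (fun x l _ => ?_) (fun x y _ => ?_)) zero_le
  · simp only [iteratedFDeriv_zero, Pi.zero_apply, ← ofReal_norm, norm_zero,
      ENNReal.ofReal_zero, le_refl]
  · simp only [iteratedFDeriv_zero, Pi.zero_apply, sub_zero]
    rw [← ofReal_norm, norm_zero, ENNReal.ofReal_zero, ENNReal.zero_div]

theorem eCHolderNorm_add_le {n : ℕ} {β : ℝ} {f g : E → F} (hf : ContDiff ℝ n f)
    (hg : ContDiff ℝ n g) :
    eCHolderNorm n β (f + g) ≤ eCHolderNorm n β f + eCHolderNorm n β g := by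
  have key : ∀ l ≤ n, ∀ x, iteratedFDeriv ℝ l (f + g) x =
      iteratedFDeriv ℝ l f x + iteratedFDeriv ℝ l g x := fun l hl x =>
    iteratedFDeriv_add_apply (hf.of_le (by exact_mod_cast hl)).contDiffAt
      (hg.of_le (by exact_mod_cast hl)).contDiffAt
  refine eCHolderNorm_le (fun x l hl => ?_) (fun x y hxy => ?_)
  · rw [key l hl x]
    exact (enorm_add_le (iteratedFDeriv ℝ l f x) (iteratedFDeriv ℝ l g x)).trans
      (add_le_add (enorm_iteratedFDeriv_le_eCHolderNorm β f hl x)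
        (enorm_iteratedFDeriv_le_eCHolderNorm β g hl x))
  · rw [key n le_rfl x, key n le_rfl y, add_sub_add_comm]
    refine (ENNReal.div_le_div_right (enorm_add_le
      (iteratedFDeriv ℝ n f x - iteratedFDeriv ℝ n f y)
      (iteratedFDeriv ℝ n g x - iteratedFDeriv ℝ n g y)) _).trans ?_
    rw [ENNReal.add_div]
    exact add_le_add (enorm_div_le_eCHolderNorm n β f hxy) (enorm_div_le_eCHolderNorm n β g hxy)

theorem eCHolderNorm_smul_le {n : ℕ} {β : ℝ} (c : ℝ) {f : E → F} (hf : ContDiff ℝ n f) :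
    eCHolderNorm n β (c • f) ≤ ‖c‖ₑ * eCHolderNorm n β f := by
  have key : ∀ l ≤ n, ∀ x, iteratedFDeriv ℝ l (c • f) x = c • iteratedFDeriv ℝ l f x :=
    fun l hl x => iteratedFDeriv_const_smul_apply (hf.of_le (by exact_mod_cast hl)).contDiffAt
  refine eCHolderNorm_le (fun x l hl => ?_) (fun x y hxy => ?_)
  · rw [key l hl x, enorm_smul]
    gcongr
    exact enorm_iteratedFDeriv_le_eCHolderNorm β f hl x
  · rw [key n le_rfl x, key n le_rfl y, ← smul_sub, enorm_smul, mul_div_assoc]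
    gcongr
    exact enorm_div_le_eCHolderNorm n β f hxy

theorem eq_zero_of_eCHolderNorm_eq_zero {n : ℕ} {β : ℝ} {f : E → F}
    (h : eCHolderNorm n β f = 0) : f = 0 := by
  funext x
  have h1 := enorm_iteratedFDeriv_le_eCHolderNorm β f (Nat.zero_le n) x
  rw [h, nonpos_iff_eq_zero, ← ofReal_norm, ENNReal.ofReal_eq_zero, norm_le_zero_iff] at h1
  rw [← iteratedFDeriv_zero_apply (𝕜 := ℝ) (f := f) (x := x) (0 : Fin 0 → E), h1]
  rfl

variable (E F) in
/-- The vector space `C^{n,β}_0(E, F)` as a subspace of all functions. -/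
def holderZeroSubmodule (n : ℕ) (β : ℝ) : Submodule ℝ (E → F) where
  carrier := {f | MemHolderZero n β f}
  zero_mem' := by
    refine ⟨⟨contDiff_const, ?_⟩, fun l _ => ?_⟩
    · rw [eCHolderNorm_zero]; exact ENNReal.zero_lt_top
    · simpa using tendsto_const_nhds
  add_mem' := by
    rintro f g ⟨⟨hf, hf'⟩, hf0⟩ ⟨⟨hg, hg'⟩, hg0⟩
    refine ⟨⟨hf.add hg, (eCHolderNorm_add_le hf hg).trans_lt (ENNReal.add_lt_top.2 ⟨hf', hg'⟩)⟩,
      fun l hl => ?_⟩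
    have h := (hf0 l hl).add (hg0 l hl)
    rw [add_zero] at h
    refine h.congr fun x => (iteratedFDeriv_add_apply
      (hf.of_le (by exact_mod_cast hl)).contDiffAt
      (hg.of_le (by exact_mod_cast hl)).contDiffAt).symm
  smul_mem' := by
    rintro c f ⟨⟨hf, hf'⟩, hf0⟩
    refine ⟨⟨hf.const_smul c, (eCHolderNorm_smul_le c hf).trans_lt
      (ENNReal.mul_lt_top enorm_lt_top hf')⟩, fun l hl => ?_⟩
    have h := (hf0 l hl).const_smul c
    rw [smul_zero] at h
    exact h.congr fun x => (iteratedFDeriv_const_smul_apply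
      (hf.of_le (by exact_mod_cast hl)).contDiffAt).symm

variable (E F) in
/-- The Hölder space `C^{n,β}_0(E, F)`. It is a type of its own, so that it carries the topology
of the norm `‖·‖_{n,β}` and not the one of pointwise convergence. -/
def HolderZero (n : ℕ) (β : ℝ) : Type _ := ↥(holderZeroSubmodule E F n β)

namespace HolderZero

variable {n : ℕ} {β : ℝ}

noncomputable instance : AddCommGroup (HolderZero E F n β) :=
  inferInstanceAs (AddCommGroup ↥(holderZeroSubmodule E F n β))

noncomputable instance : Module ℝ (HolderZero E F n β) :=
  inferInstanceAs (Module ℝ ↥(holderZeroSubmodule E F n β))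

/-- The function underlying an element of `C^{n,β}_0(E, F)`. -/
def toFun (f : HolderZero E F n β) : E → F := f.1

noncomputable instance : Norm (HolderZero E F n β) :=
  ⟨fun f => (eCHolderNorm n β f.toFun).toReal⟩

theorem norm_def (f : HolderZero E F n β) : ‖f‖ = (eCHolderNorm n β f.toFun).toReal := rfl

theorem core : NormedSpace.Core ℝ (HolderZero E F n β) where
  norm_nonneg _ := ENNReal.toReal_nonneg
  norm_smul := by
    have le : ∀ (c : ℝ) (f : HolderZero E F n β), ‖c • f‖ ≤ ‖c‖ * ‖f‖ := by
      intro c f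
      have h := ENNReal.toReal_mono (ENNReal.mul_lt_top enorm_lt_top f.2.1.2).ne
        (eCHolderNorm_smul_le (β := β) c f.2.1.1)
      rw [ENNReal.toReal_mul, toReal_enorm] at h
      exact h
    intro c f
    rcases eq_or_ne c 0 with rfl | hc
    · refine le_antisymm (le 0 f) ?_
      rw [norm_zero, zero_mul]
      exact ENNReal.toReal_nonneg
    · refine le_antisymm (le c f) ?_
      have h := le c⁻¹ (c • f)
      rw [smul_smul, inv_mul_cancel₀ hc, one_smul, norm_inv] at h
      have hc' : 0 < ‖c‖ := norm_pos_iff.2 hc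
      calc ‖c‖ * ‖f‖ ≤ ‖c‖ * (‖c‖⁻¹ * ‖c • f‖) := by gcongr
        _ = ‖c • f‖ := by rw [← mul_assoc, mul_inv_cancel₀ hc'.ne', one_mul]
  norm_triangle f g := by
    have h := ENNReal.toReal_mono (ENNReal.add_lt_top.2 ⟨f.2.1.2, g.2.1.2⟩).ne
      (eCHolderNorm_add_le (β := β) f.2.1.1 g.2.1.1)
    rw [ENNReal.toReal_add f.2.1.2.ne g.2.1.2.ne] at h
    exact h
  norm_eq_zero_iff f := by
    constructor
    · intro h
      rcases (ENNReal.toReal_eq_zero_iff _).1 h with h | h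
      · exact Subtype.ext (eq_zero_of_eCHolderNorm_eq_zero h)
      · exact absurd h f.2.1.2.ne
    · rintro rfl
      change (eCHolderNorm n β (0 : E → F)).toReal = 0
      rw [eCHolderNorm_zero, ENNReal.toReal_zero]

/-- `C^{n,β}_0(E, F)` with the norm `‖·‖_{n,β}`. -/
noncomputable instance : NormedAddCommGroup (HolderZero E F n β) := NormedAddCommGroup.ofCore core

noncomputable instance : NormedSpace ℝ (HolderZero E F n β) := NormedSpace.ofCore core

end HolderZero

end Holder

/-- The set `D^{n,β}(ℝ^d)` of all maps `Φ : ℝ^d → ℝ^d` such that `Φ - Id` belongs to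
`C^{n,β}_0(ℝ^d, ℝ^d)` and `det dΦ(x) > 0` for every `x`. -/
@[ext]
structure HolderDiffeo (n : ℕ) (β : ℝ) (d : ℕ) where
  toFun : EuclideanSpace ℝ (Fin d) → EuclideanSpace ℝ (Fin d)
  sub_id_mem : MemHolderZero n β (fun x => toFun x - x)
  det_pos : ∀ x, 0 < (fderiv ℝ toFun x).det

namespace HolderDiffeo

variable {n : ℕ} {β : ℝ} {d : ℕ}

instance : CoeFun (HolderDiffeo n β d)
    (fun _ => EuclideanSpace ℝ (Fin d) → EuclideanSpace ℝ (Fin d)) := ⟨toFun⟩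

/-- The global chart `Φ ↦ Φ - Id` with values in `C^{n,β}_0(ℝ^d, ℝ^d)`. -/
def chart (Φ : HolderDiffeo n β d) :
    HolderZero (EuclideanSpace ℝ (Fin d)) (EuclideanSpace ℝ (Fin d)) n β :=
  ⟨fun x => Φ x - x, Φ.sub_id_mem⟩

theorem chart_injective : Function.Injective (chart : HolderDiffeo n β d → _) := by
  intro Φ Ψ h
  ext1
  funext x
  exact sub_left_injective (congrFun (congrArg HolderZero.toFun h) x)

/-- `D^{n,β}(ℝ^d)` with the metric `(Φ₁, Φ₂) ↦ ‖Φ₁ - Φ₂‖_{n,β}`. -/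
noncomputable instance : MetricSpace (HolderDiffeo n β d) :=
  MetricSpace.induced chart chart_injective inferInstance

theorem dist_def (Φ Ψ : HolderDiffeo n β d) : dist Φ Ψ = ‖chart Φ - chart Ψ‖ :=
  dist_eq_norm (chart Φ) (chart Ψ)

end HolderDiffeo

/-!
The space `C^{n,β}_b` is handled through its recursive description: `f` lies in `C^{n+1,β}_b` iff
`f` is bounded and differentiable with `df` in `C^{n,β}_b` (`unifHolder_succ_iff`). Induction on
`n`, with the target space varying, then replaces all higher order chain and product rules by
their first order versions. The statements are made for families of functions with a common bound
(`UnifHolder`), which gives membership and local boundedness at the same time: the families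
bounded in `C^{n,β}_b` are stable under bilinear products (`UnifHolder.bilinear`), under
composition (`UnifHolder.comp`), under pointwise inversion of operators (`UnifHolder.ringInverse`)
and, by bootstrapping `dΨ = (dΦ)⁻¹ ∘ Ψ`, under passage to the inverse maps
(`UnifHolder.inverse_sub_id`). Decay at infinity needs to be known for the functions only, since
the Hölder bound passes it on to the derivatives (`memHolderZero_iff_tendsto`).

A map `Φ` in `D^{n,β}(ℝ^d)` is a proper local diffeomorphism. It is onto because its range is
clopen. The points with at least two preimages form a clopen set, and a point far away is not
among them because `Φ - Id` is a contraction there; so `Φ` is bijective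
(`bijective_of_isUnit_fderiv`). The derivatives `dΦ(x)` together with their limit `Id` form a
compact subset of `{det > 0}`, and a neighbourhood of it of fixed size is still a compact subset
(`HolderDiffeo.exists_thickening`). This gives openness, and a bound of `(dΦ)⁻¹` that is uniform
near a given element.

For the discontinuity, take a function `g` on the line whose `n`-th derivative is `|sin t| ^ β`
up to a constant (`exists_periodic_iteratedDeriv_eq`), and let `Ψ = Id + c ψ`, where
`ψ(x) = g(⟨e, x⟩) e` near the origin and `c > 0` is small. If `Φ_ε` is the translation by `ε e` near
the origin, the top derivative of `Ψ ∘ Φ_ε - Ψ` along `e` takes at `0` and at `-ε e` values that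
differ by the second difference `2 c |sin ε| ^ β` of `c |sin t| ^ β`. The distance of these points
is `ε`, and the Hölder quotient `2 c |sin ε| ^ β / ε ^ β` stays away from zero as `ε → 0`, although
`Φ_ε` tends to `Id`.
-/

open scoped NNReal Topology
open Filter

section UnifHolder

universe u

variable {ι : Type*} {E F G H : Type u} [NormedAddCommGroup E] [NormedSpace ℝ E]
  [NormedAddCommGroup F] [NormedSpace ℝ F] [NormedAddCommGroup G] [NormedSpace ℝ G]
  [NormedAddCommGroup H] [NormedSpace ℝ H] {n : ℕ} {β : ℝ}

/-! ### Families bounded in the Hölder norm -/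

theorem eCHolderNorm_le_coe_iff (f : E → F) (C : ℝ≥0) :
    eCHolderNorm n β f ≤ C ↔ (∀ x, ∀ l ≤ n, ‖iteratedFDeriv ℝ l f x‖ ≤ C) ∧
      ∀ x y, ‖iteratedFDeriv ℝ n f x - iteratedFDeriv ℝ n f y‖ ≤ C * ‖x - y‖ ^ β := by
  have conv : ∀ {V : Type u} [NormedAddCommGroup V] (v : V), ‖v‖ₑ ≤ C ↔ ‖v‖ ≤ C := by
    intro V _ v
    rw [← ofReal_norm, ENNReal.ofReal_le_iff_le_toReal ENNReal.coe_ne_top, ENNReal.coe_toReal]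
  have conv' : ∀ x y : E, x ≠ y →
      (‖iteratedFDeriv ℝ n f x - iteratedFDeriv ℝ n f y‖ₑ / ‖x - y‖ₑ ^ β ≤ C ↔
        ‖iteratedFDeriv ℝ n f x - iteratedFDeriv ℝ n f y‖ ≤ C * ‖x - y‖ ^ β) := by
    intro x y hxy
    have h0 : 0 < ‖x - y‖ := norm_pos_iff.2 (sub_ne_zero.2 hxy)
    have h1 : 0 < ‖x - y‖ ^ β := Real.rpow_pos_of_pos h0 β
    rw [← ofReal_norm, ← ofReal_norm (x - y), ENNReal.ofReal_rpow_of_pos h0,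
      ← ENNReal.ofReal_div_of_pos h1, ENNReal.ofReal_le_iff_le_toReal ENNReal.coe_ne_top,
      ENNReal.coe_toReal, div_le_iff₀ h1]
  constructor
  · refine fun h => ⟨fun x l hl => ?_, fun x y => ?_⟩
    · exact (conv _).1 ((enorm_iteratedFDeriv_le_eCHolderNorm β f hl x).trans h)
    · rcases eq_or_ne x y with rfl | hxy
      · rw [sub_self, norm_zero]
        positivity
      · exact (conv' x y hxy).1 ((enorm_div_le_eCHolderNorm n β f hxy).trans h)
  · rintro ⟨h1, h2⟩
    exact eCHolderNorm_le (fun x l hl => (conv _).2 (h1 x l hl))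
      fun x y hxy => (conv' x y hxy).2 (h2 x y)

/-- The family `f i` is bounded in `C^{n,β}_b(E, F)`: all members are `C^n`, and a single constant
bounds all their norms `‖·‖_{n,β}`. -/
def UnifHolder (n : ℕ) (β : ℝ) (f : ι → E → F) : Prop :=
  ∃ C : ℝ≥0, ∀ i, ContDiff ℝ n (f i) ∧ eCHolderNorm n β (f i) ≤ C

theorem UnifHolder.memHolderB {f : ι → E → F} (hf : UnifHolder n β f) (i : ι) :
    MemHolderB n β (f i) := by
  obtain ⟨C, hC⟩ := hf
  exact ⟨(hC i).1, (hC i).2.trans_lt ENNReal.coe_lt_top⟩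

theorem MemHolderB.unifHolder {f : E → F} (hf : MemHolderB n β f) :
    UnifHolder n β (fun _ : Unit => f) :=
  ⟨(eCHolderNorm n β f).toNNReal, fun _ => ⟨hf.1, by rw [ENNReal.coe_toNNReal hf.2.ne]⟩⟩

/-- Boundedness in `C^{0,β}_b`; continuity is automatic since `β > 0`. -/
theorem unifHolder_zero_iff (hβ : 0 < β) {f : ι → E → F} :
    UnifHolder 0 β f ↔ ∃ C : ℝ, ∀ i, (∀ x, ‖f i x‖ ≤ C) ∧
      ∀ x y, ‖f i x - f i y‖ ≤ C * ‖x - y‖ ^ β := by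
  have key : ∀ i (C : ℝ≥0), eCHolderNorm 0 β (f i) ≤ C ↔ (∀ x, ‖f i x‖ ≤ C) ∧
      ∀ x y, ‖f i x - f i y‖ ≤ C * ‖x - y‖ ^ β := by
    intro i C
    rw [eCHolderNorm_le_coe_iff]
    refine and_congr (forall_congr' fun x => ?_) (forall₂_congr fun x y => ?_)
    · simp
    · simp only [iteratedFDeriv_zero_eq_comp, Function.comp_apply]
      rw [← map_sub, LinearIsometryEquiv.norm_map]
  constructor
  · rintro ⟨C, hC⟩
    exact ⟨C, fun i => (key i C).1 (hC i).2⟩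
  · rintro ⟨C, hC⟩
    refine ⟨C.toNNReal, fun i => ⟨?_, (key i _).2
      ⟨fun x => ((hC i).1 x).trans (Real.le_coe_toNNReal C),
        fun x y => ((hC i).2 x y).trans ?_⟩⟩⟩
    · rw [Nat.cast_zero, contDiff_zero, continuous_iff_continuousAt]
      intro x
      rw [ContinuousAt, tendsto_iff_norm_sub_tendsto_zero]
      have h : Tendsto (fun y => C * ‖y - x‖ ^ β) (𝓝 x) (𝓝 (C * ‖x - x‖ ^ β)) :=
        (Continuous.tendsto (by fun_prop (disch := exact hβ.le)) x)
      rw [sub_self, norm_zero, Real.zero_rpow hβ.ne', mul_zero] at h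
      exact squeeze_zero (fun _ => norm_nonneg _) (fun y => (hC i).2 y x) h
    · gcongr
      exact Real.le_coe_toNNReal C

/-- Peeling off one derivative: this reduces statements about `C^{n,β}_b` to inductions on `n`
in which the target space varies. -/
theorem unifHolder_succ_iff {f : ι → E → F} :
    UnifHolder (n + 1) β f ↔ (∀ i, Differentiable ℝ (f i)) ∧ (∃ C : ℝ, ∀ i x, ‖f i x‖ ≤ C) ∧
      UnifHolder n β (fun i => fderiv ℝ (f i)) := by
  have hdiff : ∀ i x y, ‖iteratedFDeriv ℝ (n + 1) (f i) x - iteratedFDeriv ℝ (n + 1) (f i) y‖ =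
      ‖iteratedFDeriv ℝ n (fderiv ℝ (f i)) x - iteratedFDeriv ℝ n (fderiv ℝ (f i)) y‖ := by
    intro i x y
    rw [iteratedFDeriv_succ_eq_comp_right, iteratedFDeriv_succ_eq_comp_right, ← dist_eq_norm,
      ← dist_eq_norm]
    exact (continuousMultilinearCurryRightEquiv' ℝ n E F).symm.isometry.dist_eq _ _
  constructor
  · rintro ⟨C, hC⟩
    have hcd := fun i => (contDiff_succ_iff_fderiv (n := (n : ℕ∞))).1 (by exact_mod_cast (hC i).1)
    refine ⟨fun i => (hcd i).1, ⟨C, fun i x => ?_⟩, C, fun i => ⟨(hcd i).2.2, ?_⟩⟩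
    · simpa using ((eCHolderNorm_le_coe_iff _ _).1 (hC i).2).1 x 0 (Nat.zero_le _)
    · have h := (eCHolderNorm_le_coe_iff _ _).1 (hC i).2
      refine (eCHolderNorm_le_coe_iff _ _).2 ⟨fun x l hl => ?_, fun x y => ?_⟩
      · rw [norm_iteratedFDeriv_fderiv]
        exact h.1 x (l + 1) (by omega)
      · rw [← hdiff]
        exact h.2 x y
  · rintro ⟨hd, ⟨C₀, hC₀⟩, C, hC⟩
    refine ⟨max C₀.toNNReal C, fun i => ⟨?_, (eCHolderNorm_le_coe_iff _ _).2
      ⟨fun x l hl => ?_, fun x y => ?_⟩⟩⟩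
    · have := (contDiff_succ_iff_fderiv (n := (n : ℕ∞)) (f := f i) (𝕜 := ℝ)).2
        ⟨hd i, fun h => absurd h (by simp), (hC i).1⟩
      exact_mod_cast this
    · have h := (eCHolderNorm_le_coe_iff _ _).1 (hC i).2
      rw [NNReal.coe_max]
      rcases l with _ | l
      · rw [norm_iteratedFDeriv_zero]
        exact ((hC₀ i x).trans (Real.le_coe_toNNReal _)).trans (le_max_left _ _)
      · rw [← norm_iteratedFDeriv_fderiv]
        exact (h.1 x l (by omega)).trans (le_max_right _ _)
    · have h := (eCHolderNorm_le_coe_iff _ _).1 (hC i).2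
      rw [hdiff]
      refine (h.2 x y).trans ?_
      rw [NNReal.coe_max]
      gcongr
      exact le_max_right _ _

theorem UnifHolder.exists_bound {f : ι → E → F} (hf : UnifHolder n β f) :
    ∃ C : ℝ, ∀ i x, ‖f i x‖ ≤ C := by
  obtain ⟨C, hC⟩ := hf
  refine ⟨C, fun i x => ?_⟩
  simpa using ((eCHolderNorm_le_coe_iff _ _).1 (hC i).2).1 x 0 (Nat.zero_le _)

/-- A bounded family of maps with a common Lipschitz constant is bounded in `C^{0,β}_b`. -/
theorem unifHolder_zero_of_lipschitz (hβ0 : 0 < β) (hβ1 : β ≤ 1) {f : ι → E → F} {C D : ℝ}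
    (hC : ∀ i x, ‖f i x‖ ≤ C) (hD : ∀ i x y, ‖f i x - f i y‖ ≤ D * ‖x - y‖) :
    UnifHolder 0 β f := by
  refine (unifHolder_zero_iff hβ0).2 ⟨max (2 * |C|) |D|, fun i => ⟨fun x => ?_, fun x y => ?_⟩⟩
  · refine (hC i x).trans (le_trans ?_ (le_max_left _ _))
    linarith [le_abs_self C, abs_nonneg C]
  · -- The Lipschitz bound is used at distances at most `1`, the sup bound at larger ones.
    rcases le_total ‖x - y‖ 1 with h | h
    · have h1 : ‖x - y‖ ≤ ‖x - y‖ ^ β := by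
        simpa using Real.rpow_le_rpow_of_exponent_ge' (norm_nonneg (x - y)) h hβ0.le hβ1
      calc ‖f i x - f i y‖ ≤ D * ‖x - y‖ := hD i x y
        _ ≤ |D| * ‖x - y‖ := by gcongr; exact le_abs_self D
        _ ≤ max (2 * |C|) |D| * ‖x - y‖ ^ β := by gcongr; exact le_max_right _ _
    · have h1 : 1 ≤ ‖x - y‖ ^ β := Real.one_le_rpow h hβ0.le
      calc ‖f i x - f i y‖ ≤ ‖f i x‖ + ‖f i y‖ := norm_sub_le _ _
        _ ≤ C + C := add_le_add (hC i x) (hC i y)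
        _ ≤ 2 * |C| * 1 := by linarith [le_abs_self C]
        _ ≤ max (2 * |C|) |D| * ‖x - y‖ ^ β := by gcongr; exact le_max_left _ _

theorem norm_sub_le_of_norm_fderiv_le {f : E → F} (hf : Differentiable ℝ f) {C : ℝ}
    (hC : ∀ x, ‖fderiv ℝ f x‖ ≤ C) (x y : E) : ‖f x - f y‖ ≤ C * ‖x - y‖ :=
  convex_univ.norm_image_sub_le_of_norm_fderiv_le (𝕜 := ℝ) (fun z _ => hf z) (fun z _ => hC z)
    (Set.mem_univ y) (Set.mem_univ x)

theorem UnifHolder.exists_lipschitz {f : ι → E → F} (hf : UnifHolder (n + 1) β f) :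
    ∃ C : ℝ, ∀ i x y, ‖f i x - f i y‖ ≤ C * ‖x - y‖ := by
  obtain ⟨hd, -, hf'⟩ := unifHolder_succ_iff.1 hf
  obtain ⟨C, hC⟩ := hf'.exists_bound
  exact ⟨C, fun i => norm_sub_le_of_norm_fderiv_le (hd i) (hC i)⟩

theorem UnifHolder.of_succ (hβ0 : 0 < β) (hβ1 : β ≤ 1) {f : ι → E → F}
    (hf : UnifHolder (n + 1) β f) : UnifHolder n β f := by
  induction n generalizing F with
  | zero =>
    obtain ⟨C, hC⟩ := hf.exists_bound
    obtain ⟨D, hD⟩ := hf.exists_lipschitz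
    exact unifHolder_zero_of_lipschitz hβ0 hβ1 hC hD
  | succ n ih =>
    obtain ⟨hd, hb, hf'⟩ := unifHolder_succ_iff.1 hf
    exact unifHolder_succ_iff.2 ⟨hd, hb, ih hf'⟩

theorem UnifHolder.of_le (hβ0 : 0 < β) (hβ1 : β ≤ 1) {f : ι → E → F} {m : ℕ}
    (hf : UnifHolder n β f) (hmn : m ≤ n) : UnifHolder m β f := by
  induction hmn using Nat.decreasingInduction with
  | of_succ k _ ih => exact ih.of_succ hβ0 hβ1
  | self => exact hf

theorem unifHolder_const (hβ : 0 < β) (c : F) : UnifHolder n β (fun (_ : ι) (_ : E) => c) := by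
  induction n generalizing F with
  | zero =>
    refine (unifHolder_zero_iff hβ).2 ⟨‖c‖, fun i => ⟨fun x => le_rfl, fun x y => ?_⟩⟩
    rw [sub_self, norm_zero]
    positivity
  | succ n ih =>
    refine unifHolder_succ_iff.2 ⟨fun i => differentiable_const c, ⟨‖c‖, fun _ _ => le_rfl⟩, ?_⟩
    simpa [fderiv_fun_const, Pi.zero_def] using ih (0 : E →L[ℝ] F)

theorem UnifHolder.add {f g : ι → E → F} (hf : UnifHolder n β f) (hg : UnifHolder n β g) :
    UnifHolder n β (fun i x => f i x + g i x) := by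
  obtain ⟨C, hC⟩ := hf
  obtain ⟨D, hD⟩ := hg
  refine ⟨C + D, fun i => ⟨(hC i).1.add (hD i).1, ?_⟩⟩
  rw [ENNReal.coe_add]
  exact (eCHolderNorm_add_le (hC i).1 (hD i).1).trans (add_le_add (hC i).2 (hD i).2)

theorem UnifHolder.const_smul {f : ι → E → F} (hf : UnifHolder n β f) (c : ℝ) :
    UnifHolder n β (fun i x => c • f i x) := by
  obtain ⟨C, hC⟩ := hf
  refine ⟨‖c‖₊ * C, fun i => ⟨(hC i).1.const_smul c, ?_⟩⟩
  rw [ENNReal.coe_mul]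
  exact (eCHolderNorm_smul_le c (hC i).1).trans (mul_le_mul' le_rfl (hC i).2)

theorem UnifHolder.neg {f : ι → E → F} (hf : UnifHolder n β f) :
    UnifHolder n β (fun i x => -f i x) := by
  simpa using hf.const_smul (-1)

theorem UnifHolder.sub {f g : ι → E → F} (hf : UnifHolder n β f) (hg : UnifHolder n β g) :
    UnifHolder n β (fun i x => f i x - g i x) := by
  simpa [sub_eq_add_neg] using hf.add hg.neg

/-! ### Products, compositions and inverses -/

/-- The spaces `C^{n,β}_b` are stable under bilinear products. -/
theorem UnifHolder.bilinear (hβ0 : 0 < β) (hβ1 : β ≤ 1) (B : F →L[ℝ] G →L[ℝ] H) {f : ι → E → F}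
    {g : ι → E → G} (hf : UnifHolder n β f) (hg : UnifHolder n β g) :
    UnifHolder n β (fun i x => B (f i x) (g i x)) := by
  induction n generalizing F G H with
  | zero =>
    obtain ⟨C, hC⟩ := (unifHolder_zero_iff hβ0).1 hf
    obtain ⟨D, hD⟩ := (unifHolder_zero_iff hβ0).1 hg
    refine (unifHolder_zero_iff hβ0).2 ⟨2 * (‖B‖ * |C| * |D|), 
      fun i => ⟨fun x => ?_, fun x y => ?_⟩⟩
    · refine (B.le_of_opNorm₂_le_of_le le_rfl (((hC i).1 x).trans (le_abs_self C))
        (((hD i).1 x).trans (le_abs_self D))).trans ?_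
      have : 0 ≤ ‖B‖ * |C| * |D| := by positivity
      linarith
    · have e : B (f i x) (g i x) - B (f i y) (g i y) =
          B (f i x - f i y) (g i x) + B (f i y) (g i x - g i y) := by
        simp
      rw [e]
      have h1 : ‖B (f i x - f i y) (g i x)‖ ≤ ‖B‖ * (|C| * ‖x - y‖ ^ β) * |D| :=
        B.le_of_opNorm₂_le_of_le le_rfl (((hC i).2 x y).trans (by gcongr; exact le_abs_self C))
          (((hD i).1 x).trans (le_abs_self D))
      have h2 : ‖B (f i y) (g i x - g i y)‖ ≤ ‖B‖ * |C| * (|D| * ‖x - y‖ ^ β) :=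
        B.le_of_opNorm₂_le_of_le le_rfl (((hC i).1 y).trans (le_abs_self C))
          (((hD i).2 x y).trans (by gcongr; exact le_abs_self D))
      refine (norm_add_le _ _).trans ((add_le_add h1 h2).trans (le_of_eq ?_))
      ring
  | succ n ih =>
    have hf0 := hf.of_succ hβ0 hβ1
    have hg0 := hg.of_succ hβ0 hβ1
    obtain ⟨hfd, ⟨C, hC⟩, hf'⟩ := unifHolder_succ_iff.1 hf
    obtain ⟨hgd, ⟨D, hD⟩, hg'⟩ := unifHolder_succ_iff.1 hg
    refine unifHolder_succ_iff.2 ⟨fun i x => ?_, ⟨_, fun i x =>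
      B.le_of_opNorm₂_le_of_le le_rfl (hC i x) (hD i x)⟩, ?_⟩
    · exact (B.hasFDerivAt_of_bilinear (hfd i x).hasFDerivAt (hgd i x).hasFDerivAt).differentiableAt
    · have e : (fun i => fderiv ℝ (fun x => B (f i x) (g i x))) =
          fun i x => B.precompR E (f i x) (fderiv ℝ (g i) x) +
            B.precompL E (fderiv ℝ (f i) x) (g i x) := by
        funext i x
        exact B.fderiv_of_bilinear (hfd i x) (hgd i x)
      rw [e]
      exact (ih _ hf0 hg').add (ih _ hf' hg0)

theorem UnifHolder.clm_comp (hβ0 : 0 < β) (hβ1 : β ≤ 1) {f : ι → E → G →L[ℝ] H}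
    {g : ι → E → F →L[ℝ] G} (hf : UnifHolder n β f) (hg : UnifHolder n β g) :
    UnifHolder n β (fun i x => (f i x).comp (g i x)) :=
  UnifHolder.bilinear hβ0 hβ1 (ContinuousLinearMap.compL ℝ F G H) hf hg

/-- Composition `f i ∘ φ i`. Only the derivative of the inner map has to be bounded, so that
`φ i` may be a perturbation of the identity, or linear. -/
theorem UnifHolder.comp (hβ0 : 0 < β) (hβ1 : β ≤ 1) {f : ι → F → G} {φ : ι → E → F} {L : ℝ}
    (hf : UnifHolder n β f) (hL : ∀ i x y, ‖φ i x - φ i y‖ ≤ L * ‖x - y‖)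
    (hφ : ∀ m, m + 1 ≤ n → (∀ i, Differentiable ℝ (φ i)) ∧
      UnifHolder m β (fun i => fderiv ℝ (φ i))) :
    UnifHolder n β (fun i x => f i (φ i x)) := by
  induction n generalizing G with
  | zero =>
    obtain ⟨C, hC⟩ := (unifHolder_zero_iff hβ0).1 hf
    refine (unifHolder_zero_iff hβ0).2 ⟨max |C| (|C| * |L| ^ β),
      fun i => ⟨fun x => ?_, fun x y => ?_⟩⟩
    · exact (((hC i).1 _).trans (le_abs_self C)).trans (le_max_left _ _)
    · calc ‖f i (φ i x) - f i (φ i y)‖ ≤ C * ‖φ i x - φ i y‖ ^ β := (hC i).2 _ _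
        _ ≤ |C| * (|L| * ‖x - y‖) ^ β := by
          gcongr
          · exact le_abs_self C
          · exact (hL i x y).trans (by gcongr; exact le_abs_self L)
        _ = |C| * |L| ^ β * ‖x - y‖ ^ β := by
          rw [Real.mul_rpow (abs_nonneg L) (norm_nonneg _), mul_assoc]
        _ ≤ _ := by gcongr; exact le_max_right _ _
  | succ n ih =>
    obtain ⟨hfd, ⟨C, hC⟩, hf'⟩ := unifHolder_succ_iff.1 hf
    obtain ⟨hφd, hφ'⟩ := hφ n le_rfl
    refine unifHolder_succ_iff.2 ⟨fun i => (hfd i).comp (hφd i), ⟨C, fun i x => hC i _⟩, ?_⟩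
    have e : (fun i => fderiv ℝ (fun x => f i (φ i x))) =
        fun i x => (fderiv ℝ (f i) (φ i x)).comp (fderiv ℝ (φ i) x) := by
      funext i x
      exact fderiv_comp x (hfd i _) (hφd i x)
    rw [e]
    exact (ih hf' fun m hm => hφ m (by omega)).clm_comp hβ0 hβ1 hφ'

theorem differentiableAt_and_fderiv_eq_id_add {φ : E → E}
    (hφ : Differentiable ℝ (fun x => φ x - x)) (x : E) :
    DifferentiableAt ℝ φ x ∧
      fderiv ℝ φ x = ContinuousLinearMap.id ℝ E + fderiv ℝ (fun x => φ x - x) x := by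
  have h : HasFDerivAt φ (ContinuousLinearMap.id ℝ E + fderiv ℝ (fun x => φ x - x) x) x := by
    have := (hasFDerivAt_id x).add (hφ x).hasFDerivAt
    refine this.congr_of_eventuallyEq (Eventually.of_forall fun y => ?_)
    simp
  exact ⟨h.differentiableAt, h.fderiv⟩

/-- Composition with maps `φ i = Id + (φ i - Id)`, uniformly Lipschitz, whose distance to the
identity is bounded in `C^{n,β}_b`. -/
theorem UnifHolder.comp_of_sub_id (hβ0 : 0 < β) (hβ1 : β ≤ 1) {f : ι → E → G} {φ : ι → E → E}
    {L : ℝ} (hf : UnifHolder n β f) (hL : ∀ i x y, ‖φ i x - φ i y‖ ≤ L * ‖x - y‖)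
    (hφ : UnifHolder n β (fun i x => φ i x - x)) :
    UnifHolder n β (fun i x => f i (φ i x)) := by
  refine hf.comp hβ0 hβ1 hL fun m hm => ?_
  obtain ⟨hd, -, h'⟩ := unifHolder_succ_iff.1 (hφ.of_le hβ0 hβ1 hm)
  refine ⟨fun i x => (differentiableAt_and_fderiv_eq_id_add (hd i) x).1, ?_⟩
  have e : (fun i => fderiv ℝ (φ i)) =
      fun i x => ContinuousLinearMap.id ℝ E + fderiv ℝ (fun x => φ i x - x) x := by
    funext i x
    exact (differentiableAt_and_fderiv_eq_id_add (hd i) x).2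
  rw [e]
  exact (unifHolder_const hβ0 _).add h'

theorem norm_sub_le_of_sub_id {V : Type*} [SeminormedAddCommGroup V] {φ : V → V} {L : ℝ}
    (hL : ∀ x y, ‖(φ x - x) - (φ y - y)‖ ≤ L * ‖x - y‖) (x y : V) :
    ‖φ x - φ y‖ ≤ (L + 1) * ‖x - y‖ := by
  have e : φ x - φ y = ((φ x - x) - (φ y - y)) + (x - y) := by abel
  rw [e]
  refine (norm_add_le _ _).trans ?_
  linarith [hL x y]

/-- Pointwise inversion of a bounded family of maps into the units of a Banach algebra preserves
boundedness in `C^{n,β}_b`, as soon as the inverses are uniformly bounded. -/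
theorem UnifHolder.ringInverse {R : Type u} [NormedRing R] [NormedAlgebra ℝ R] [CompleteSpace R]
    (hβ0 : 0 < β) (hβ1 : β ≤ 1) {M : ι → E → R} {C : ℝ} (hM : UnifHolder n β M)
    (hu : ∀ i x, IsUnit (M i x)) (hC : ∀ i x, ‖Ring.inverse (M i x)‖ ≤ C) :
    UnifHolder n β (fun i x => Ring.inverse (M i x)) := by
  induction n with
  | zero =>
    obtain ⟨D, hD⟩ := (unifHolder_zero_iff hβ0).1 hM
    refine (unifHolder_zero_iff hβ0).2 ⟨max C (|C| * |D| * |C|),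
      fun i => ⟨fun x => ?_, fun x y => ?_⟩⟩
    · exact (hC i x).trans (le_max_left _ _)
    · have e : Ring.inverse (M i x) - Ring.inverse (M i y) =
          Ring.inverse (M i x) * (M i y - M i x) * Ring.inverse (M i y) := by
        rw [mul_sub, Ring.inverse_mul_cancel _ (hu i x), sub_mul, one_mul, mul_assoc,
          Ring.mul_inverse_cancel _ (hu i y), mul_one]
      rw [e]
      calc ‖Ring.inverse (M i x) * (M i y - M i x) * Ring.inverse (M i y)‖
          ≤ ‖Ring.inverse (M i x)‖ * ‖M i y - M i x‖ * ‖Ring.inverse (M i y)‖ :=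
            (norm_mul_le _ _).trans (by gcongr; exact norm_mul_le _ _)
        _ ≤ |C| * (|D| * ‖x - y‖ ^ β) * |C| := by
            gcongr
            · exact (hC i x).trans (le_abs_self C)
            · rw [norm_sub_rev]
              exact ((hD i).2 x y).trans (by gcongr; exact le_abs_self D)
            · exact (hC i y).trans (le_abs_self C)
        _ = |C| * |D| * |C| * ‖x - y‖ ^ β := by ring
        _ ≤ _ := by gcongr; exact le_max_right _ _
  | succ n ih =>
    have hA := ih (hM.of_succ hβ0 hβ1)
    obtain ⟨hd, -, hM'⟩ := unifHolder_succ_iff.1 hM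
    have hder : ∀ i x, HasFDerivAt (fun x => Ring.inverse (M i x))
        ((-(ContinuousLinearMap.mulLeftRight ℝ R (Ring.inverse (M i x))
          (Ring.inverse (M i x)))).comp (fderiv ℝ (M i) x)) x := by
      intro i x
      obtain ⟨U, hU⟩ := hu i x
      have h := hasFDerivAt_ringInverse (𝕜 := ℝ) U
      rw [← hU, Ring.inverse_unit]
      rw [hU] at h
      exact h.comp x (hd i x).hasFDerivAt
    refine unifHolder_succ_iff.2 ⟨fun i x => (hder i x).differentiableAt, ⟨C, hC⟩, ?_⟩
    have e : (fun i => fderiv ℝ (fun x => Ring.inverse (M i x))) = fun i x =>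
        (-(ContinuousLinearMap.mulLeftRight ℝ R (Ring.inverse (M i x))
          (Ring.inverse (M i x)))).comp (fderiv ℝ (M i) x) := by
      funext i x
      exact (hder i x).fderiv
    rw [e]
    exact ((hA.bilinear hβ0 hβ1 (ContinuousLinearMap.mulLeftRight ℝ R) hA).neg).clm_comp
      hβ0 hβ1 hM'

/-- Inverse maps: if the `φ i - Id` are bounded in `C^{n+1,β}_b` and the inverses of the
derivatives of `φ i` are uniformly bounded, then the `ψ i - Id` are bounded in `C^{n+1,β}_b`, where
`ψ i` is the inverse map of `φ i`. The regularity is bootstrapped from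
`dψ = (dφ)⁻¹ ∘ ψ`. -/
theorem UnifHolder.inverse_sub_id [CompleteSpace E] (hβ0 : 0 < β) (hβ1 : β ≤ 1)
    {φ ψ : ι → E → E} {C : ℝ}
    (hφ : UnifHolder (n + 1) β (fun i x => φ i x - x))
    (hu : ∀ i x, IsUnit (fderiv ℝ (φ i) x)) (hC : ∀ i x, ‖Ring.inverse (fderiv ℝ (φ i) x)‖ ≤ C)
    (hright : ∀ i y, φ i (ψ i y) = y)
    (hψ : ∀ i y, HasFDerivAt (ψ i) (Ring.inverse (fderiv ℝ (φ i) (ψ i y))) y) :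
    UnifHolder (n + 1) β (fun i y => ψ i y - y) := by
  obtain ⟨hd, hb, hφ'⟩ := unifHolder_succ_iff.1 hφ
  have hA : UnifHolder n β (fun i x => Ring.inverse (fderiv ℝ (φ i) x)) := by
    refine UnifHolder.ringInverse hβ0 hβ1 ?_ hu hC
    have e : (fun i => fderiv ℝ (φ i)) =
        fun i x => ContinuousLinearMap.id ℝ E + fderiv ℝ (fun x => φ i x - x) x := by
      funext i x
      exact (differentiableAt_and_fderiv_eq_id_add (hd i) x).2
    rw [e]
    exact (unifHolder_const hβ0 _).add hφ'
  have hψL : ∀ i x y, ‖ψ i x - ψ i y‖ ≤ C * ‖x - y‖ := fun i =>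
    norm_sub_le_of_norm_fderiv_le (fun y => (hψ i y).differentiableAt)
      (fun y => by rw [(hψ i y).fderiv]; exact hC i _)
  obtain ⟨D, hD⟩ := hb
  -- At `x = ψ y` the displacement `φ x - x` is `y - ψ y`.
  have hψb : ∀ i y, ‖ψ i y - y‖ ≤ D := by
    intro i y
    have h := hD i (ψ i y)
    rwa [hright, norm_sub_rev] at h
  have hder : ∀ i y, HasFDerivAt (fun y => ψ i y - y)
      (Ring.inverse (fderiv ℝ (φ i) (ψ i y)) - ContinuousLinearMap.id ℝ E) y :=
    fun i y => (hψ i y).sub (hasFDerivAt_id y)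
  -- If `ψ - Id` is bounded in `C^{k,β}_b` for some `k ≤ n`, then so is `dψ = (dφ)⁻¹ ∘ ψ`.
  suffices h : ∀ k ≤ n + 1, UnifHolder k β (fun i y => ψ i y - y) from h _ le_rfl
  intro k
  induction k with
  | zero =>
    intro _
    refine unifHolder_zero_of_lipschitz hβ0 hβ1 hψb (D := C + 1) fun i x y => ?_
    have e : (ψ i x - x) - (ψ i y - y) = (ψ i x - ψ i y) - (x - y) := by abel
    rw [e]
    refine (norm_sub_le _ _).trans ?_
    linarith [hψL i x y]
  | succ k ih =>
    intro hk
    refine unifHolder_succ_iff.2 ⟨fun i y => (hder i y).differentiableAt, ⟨D, hψb⟩, ?_⟩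
    have e : (fun i => fderiv ℝ (fun y => ψ i y - y)) = fun i y =>
        Ring.inverse (fderiv ℝ (φ i) (ψ i y)) - ContinuousLinearMap.id ℝ E := by
      funext i y
      exact (hder i y).fderiv
    rw [e]
    exact ((hA.of_le hβ0 hβ1 (by omega)).comp_of_sub_id hβ0 hβ1 hψL (ih (by omega))).sub
      (unifHolder_const hβ0 _)

end UnifHolder

section Vanishing

universe u

variable {E F : Type u} [NormedAddCommGroup E] [NormedSpace ℝ E]
  [NormedAddCommGroup F] [NormedSpace ℝ F] {n : ℕ} {β : ℝ}

/-! ### Decay at infinity -/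

/-- A function that tends to zero at infinity and has a Hölder continuous derivative has a
derivative that tends to zero at infinity: over a ball of small radius `r` the function is
affine up to `o(r)`, so that its derivative is controlled by its values. -/
theorem tendsto_fderiv_cobounded_zero (hβ : 0 < β) {f : E → F} {C : ℝ} (hd : Differentiable ℝ f)
    (hC : ∀ x y, ‖fderiv ℝ f x - fderiv ℝ f y‖ ≤ C * ‖x - y‖ ^ β)
    (h0 : Tendsto f (Bornology.cobounded E) (𝓝 0)) :
    Tendsto (fderiv ℝ f) (Bornology.cobounded E) (𝓝 0) := by
  rw [NormedAddGroup.tendsto_nhds_zero] at h0 ⊢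
  intro ε hε
  obtain ⟨r, hr0, hr⟩ : ∃ r > 0, |C| * r ^ β < ε / 4 := by
    have h : Tendsto (fun r : ℝ => |C| * r ^ β) (𝓝[>] 0) (𝓝 (|C| * 0 ^ β)) :=
      ((Real.continuousAt_rpow_const 0 β (Or.inr hβ.le)).tendsto.const_mul _).mono_left
        nhdsWithin_le_nhds
    rw [Real.zero_rpow hβ.ne', mul_zero] at h
    obtain ⟨r, hr, hr'⟩ := ((h.eventually_lt_const (by positivity : (0 : ℝ) < ε / 4)).and
      self_mem_nhdsWithin).exists
    exact ⟨r, hr', hr⟩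
  obtain ⟨R, -, hR⟩ := (hasBasis_cobounded_norm.eventually_iff).1 (h0 (r * ε / 8) (by positivity))
  refine hasBasis_cobounded_norm.eventually_iff.2 ⟨R + r, trivial, fun x hx => ?_⟩
  rw [Set.mem_ofPred_eq] at hx
  refine lt_of_le_of_lt (ContinuousLinearMap.opNorm_le_of_unit_norm (C := ε / 2) (by positivity)
    fun u hu => ?_) (by linarith)
  have hru : ‖r • u‖ = r := by rw [norm_smul, hu, mul_one, Real.norm_of_nonneg hr0.le]
  have h1 : ‖f (x + r • u) - f x - fderiv ℝ f x (x + r • u - x)‖ ≤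
      |C| * r ^ β * ‖x + r • u - x‖ := by
    refine (convex_closedBall x r).norm_image_sub_le_of_norm_fderiv_le' (𝕜 := ℝ)
      (fun z _ => hd z) (fun z hz => ?_) (Metric.mem_closedBall_self hr0.le) ?_
    · refine (hC z x).trans ?_
      have hz' : ‖z - x‖ ≤ r := by rwa [← dist_eq_norm]
      gcongr
      exact le_abs_self C
    · rw [mem_closedBall_iff_norm, add_sub_cancel_left, hru]
  rw [add_sub_cancel_left, hru] at h1
  have h2 : ‖f x‖ < r * ε / 8 := hR (by rw [Set.mem_ofPred_eq]; linarith)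
  have h3 : ‖f (x + r • u)‖ < r * ε / 8 := by
    refine hR ?_
    rw [Set.mem_ofPred_eq]
    have := norm_sub_le (x + r • u) (r • u)
    rw [add_sub_cancel_right, hru] at this
    linarith
  have h4 : ‖fderiv ℝ f x (r • u)‖ ≤ |C| * r ^ β * r + r * ε / 4 := by
    have e : fderiv ℝ f x (r • u) =
        (f (x + r • u) - f x) - (f (x + r • u) - f x - fderiv ℝ f x (r • u)) := by abel
    rw [e]
    refine (norm_sub_le _ _).trans ?_
    linarith [norm_sub_le (f (x + r • u)) (f x)]
  rw [map_smul, norm_smul, Real.norm_of_nonneg hr0.le] at h4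
  have h5 : r * ‖fderiv ℝ f x u‖ ≤ r * (ε / 2) := by nlinarith
  exact le_of_mul_le_mul_left h5 hr0

theorem UnifHolder.tendsto_iteratedFDeriv (hβ0 : 0 < β) (hβ1 : β ≤ 1) {f : E → F}
    (hf : UnifHolder n β (fun _ : Unit => f))
    (h0 : Tendsto f (Bornology.cobounded E) (𝓝 0)) (l : ℕ) (hl : l ≤ n) :
    Tendsto (fun x => iteratedFDeriv ℝ l f x) (Bornology.cobounded E) (𝓝 0) := by
  induction l generalizing F n with
  | zero =>
    rw [tendsto_zero_iff_norm_tendsto_zero] at h0 ⊢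
    simpa using h0
  | succ l ih =>
    obtain ⟨n, rfl⟩ : ∃ k, n = k + 1 := ⟨n - 1, by omega⟩
    obtain ⟨hd, -, hf'⟩ := unifHolder_succ_iff.1 hf
    obtain ⟨C, hC⟩ := (unifHolder_zero_iff hβ0).1 (hf'.of_le hβ0 hβ1 (Nat.zero_le n))
    have h := ih hf' (tendsto_fderiv_cobounded_zero hβ0 (hd ()) (hC ()).2 h0) (by omega)
    rw [tendsto_zero_iff_norm_tendsto_zero] at h ⊢
    simpa only [norm_iteratedFDeriv_fderiv] using h

/-- For functions in `C^{n,β}_b`, decay of the function itself forces decay of its derivatives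
up to order `n`. -/
theorem memHolderZero_iff_tendsto (hβ0 : 0 < β) (hβ1 : β ≤ 1) {f : E → F} :
    MemHolderZero n β f ↔ MemHolderB n β f ∧ Tendsto f (Bornology.cobounded E) (𝓝 0) := by
  refine ⟨fun h => ⟨h.1, ?_⟩, fun h => ⟨h.1, h.1.unifHolder.tendsto_iteratedFDeriv hβ0 hβ1 h.2⟩⟩
  have h0 := h.2 0 (Nat.zero_le n)
  rw [tendsto_zero_iff_norm_tendsto_zero] at h0 ⊢
  simpa using h0

end Vanishing

section GlobalInverse

variable {E : Type*} [NormedAddCommGroup E] [NormedSpace ℝ E] {Φ : E → E}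

/-! ### Local diffeomorphisms asymptotic to the identity -/

theorem tendsto_cobounded_of_sub_id_bounded {V : Type*} [SeminormedAddCommGroup V] {Φ : V → V}
    {C : ℝ} (hC : ∀ x, ‖Φ x - x‖ ≤ C) :
    Tendsto Φ (Bornology.cobounded V)
      (Bornology.cobounded V) := by
  rw [← tendsto_norm_atTop_iff_cobounded]
  refine tendsto_atTop_mono (f := fun x => ‖x‖ - C) (fun x => ?_)
    (tendsto_atTop_add_const_right _ (-C) tendsto_norm_cobounded_atTop)
  have := norm_sub_norm_le x (Φ x)
  rw [norm_sub_rev] at this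
  linarith [hC x]

theorem hasStrictFDerivAt_equiv_of_isUnit (hΦ : ContDiff ℝ 1 Φ) {x : E}
    (hu : IsUnit (fderiv ℝ Φ x)) :
    ∃ e : E ≃L[ℝ] E, (e : E →L[ℝ] E) = fderiv ℝ Φ x ∧ (e.symm : E →L[ℝ] E) =
      Ring.inverse (fderiv ℝ Φ x) ∧ HasStrictFDerivAt Φ (e : E →L[ℝ] E) x := by
  obtain ⟨U, hU⟩ := hu
  refine ⟨ContinuousLinearEquiv.unitsEquiv ℝ E U, hU, ?_, ?_⟩
  · rw [← hU, Ring.inverse_unit]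
    rfl
  · have h := hΦ.hasStrictFDerivAt (x := x) one_ne_zero
    rw [← hU] at h
    exact h

variable [FiniteDimensional ℝ E]

theorem isProperMap_of_sub_id_bounded (hc : Continuous Φ) {C : ℝ} (hC : ∀ x, ‖Φ x - x‖ ≤ C) :
    IsProperMap Φ := by
  have : ProperSpace E := FiniteDimensional.proper ℝ E
  refine isProperMap_iff_tendsto_cocompact.2 ⟨hc, ?_⟩
  rw [← Metric.cobounded_eq_cocompact]
  exact tendsto_cobounded_of_sub_id_bounded hC

/-- A proper local diffeomorphism of the connected space `E` is onto, since its range is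
clopen. -/
theorem surjective_of_isUnit_fderiv (hΦ : ContDiff ℝ 1 Φ) (hu : ∀ x, IsUnit (fderiv ℝ Φ x))
    (hp : IsProperMap Φ) : Function.Surjective Φ := by
  have : CompleteSpace E := FiniteDimensional.complete ℝ E
  choose e _ _ he using fun x => hasStrictFDerivAt_equiv_of_isUnit hΦ (hu x)
  have hopen : IsOpenMap Φ := isOpenMap_of_hasStrictFDerivAt_equiv he
  rw [← Set.range_eq_univ]
  exact IsClopen.eq_univ ⟨hp.isClosedMap.isClosed_range, hopen.isOpen_range⟩
    (Set.range_nonempty Φ)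

/-- The set of points with at least two preimages under a proper local diffeomorphism is
clopen, so that it is empty once a single point is missing from it. Properness makes it closed:
limits of two distinct preimages remain distinct because of local injectivity. -/
theorem injective_of_isUnit_fderiv (hΦ : ContDiff ℝ 1 Φ) (hu : ∀ x, IsUnit (fderiv ℝ Φ x))
    (hp : IsProperMap Φ) (hy : ∃ y, ∀ x₁ x₂, Φ x₁ = y → Φ x₂ = y → x₁ = x₂) :
    Function.Injective Φ := by
  have : CompleteSpace E := FiniteDimensional.complete ℝ E
  choose e _ _ he using fun x => hasStrictFDerivAt_equiv_of_isUnit hΦ (hu x)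
  have hopen : IsOpenMap Φ := isOpenMap_of_hasStrictFDerivAt_equiv he
  have hinj : ∀ x, ∃ U ∈ 𝓝 x, Set.InjOn Φ U := fun x =>
    ⟨((he x).toOpenPartialHomeomorph Φ).source,
      ((he x).toOpenPartialHomeomorph Φ).open_source.mem_nhds
        (he x).mem_toOpenPartialHomeomorph_source,
      ((he x).toOpenPartialHomeomorph Φ).injOn⟩
  -- By local injectivity, the diagonal is relatively open in `{(x₁, x₂) | Φ x₁ = Φ x₂}`.
  set T : Set (E × E) := {p | Φ p.1 = Φ p.2 ∧ p.1 ≠ p.2} with hT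
  have hTclosed : IsClosed T := by
    rw [← isOpen_compl_iff, isOpen_iff_mem_nhds]
    rintro ⟨x₁, x₂⟩ h
    by_cases hx : Φ x₁ = Φ x₂
    · have hx' : x₁ = x₂ := by
        by_contra hne
        exact h ⟨hx, hne⟩
      subst hx'
      obtain ⟨U, hU, hUinj⟩ := hinj x₁
      filter_upwards [prod_mem_nhds hU hU] with p hp' hpT
      exact hpT.2 (hUinj hp'.1 hp'.2 hpT.1)
    · have hne : {p : E × E | Φ p.1 ≠ Φ p.2} ∈ 𝓝 (x₁, x₂) :=
        (isOpen_ne_fun (hΦ.continuous.comp continuous_fst)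
          (hΦ.continuous.comp continuous_snd)).mem_nhds hx
      filter_upwards [hne] with p hp' hpT
      exact hp' hpT.1
  set S : Set E := {y | ∃ x₁ x₂, Φ x₁ = y ∧ Φ x₂ = y ∧ x₁ ≠ x₂} with hS
  have hSclosed : IsClosed S := by
    have h1 : IsClosed (Prod.map Φ Φ '' T) := (hp.prodMap hp).isClosedMap _ hTclosed
    have h2 : S = (fun y => (y, y)) ⁻¹' (Prod.map Φ Φ '' T) := by
      ext y
      constructor
      · rintro ⟨x₁, x₂, h₁, h₂, hne⟩
        exact ⟨(x₁, x₂), ⟨h₁.trans h₂.symm, hne⟩, Prod.ext h₁ h₂⟩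
      · rintro ⟨⟨x₁, x₂⟩, ⟨-, hne⟩, h⟩
        exact ⟨x₁, x₂, congrArg Prod.fst h, congrArg Prod.snd h, hne⟩
    rw [h2]
    exact h1.preimage (by fun_prop)
  have hSopen : IsOpen S := by
    rw [isOpen_iff_mem_nhds]
    rintro y ⟨x₁, x₂, h₁, h₂, hne⟩
    obtain ⟨U, V, hU, hV, hxU, hxV, hUV⟩ := t2_separation hne
    have hU' : Φ '' U ∈ 𝓝 y := (hopen U hU).mem_nhds ⟨x₁, hxU, h₁⟩
    have hV' : Φ '' V ∈ 𝓝 y := (hopen V hV).mem_nhds ⟨x₂, hxV, h₂⟩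
    filter_upwards [hU', hV']
    rintro z ⟨a, ha, haz⟩ ⟨b, hb, hbz⟩
    exact ⟨a, b, haz, hbz, fun hab => Set.disjoint_left.1 hUV ha (hab ▸ hb)⟩
  have hSempty : S = ∅ := by
    rcases isClopen_iff.1 ⟨hSclosed, hSopen⟩ with h | h
    · exact h
    · obtain ⟨y, hy⟩ := hy
      obtain ⟨x₁, x₂, h₁, h₂, hne⟩ : y ∈ S := h ▸ Set.mem_univ y
      exact absurd (hy x₁ x₂ h₁ h₂) hne
  intro x₁ x₂ h
  by_contra hne
  have : Φ x₂ ∈ S := ⟨x₁, x₂, h, rfl, hne⟩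
  rw [hSempty] at this
  exact this

/-- A local diffeomorphism at bounded distance from the identity whose derivative tends to the
identity at infinity is bijective. Far away it is the identity plus a contraction, so that far
points have a single preimage. -/
theorem bijective_of_isUnit_fderiv (hΦ : ContDiff ℝ 1 Φ) (hu : ∀ x, IsUnit (fderiv ℝ Φ x)) {C : ℝ}
    (hC : ∀ x, ‖Φ x - x‖ ≤ C)
    (h0 : Tendsto (fderiv ℝ (fun x => Φ x - x)) (Bornology.cobounded E) (𝓝 0)) :
    Function.Bijective Φ := by
  have hp := isProperMap_of_sub_id_bounded hΦ.continuous hC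
  refine ⟨?_, surjective_of_isUnit_fderiv hΦ hu hp⟩
  -- In the zero space there are no far points.
  rcases subsingleton_or_nontrivial E with hE | hE
  · exact Function.injective_of_subsingleton Φ
  refine injective_of_isUnit_fderiv hΦ hu hp ?_
  -- All preimages of `y` lie in `closedBall y C`, hence outside the ball of radius `R`, where
  -- `Φ - Id` has Lipschitz constant `1 / 2`.
  obtain ⟨R, -, hR⟩ := hasBasis_cobounded_norm.eventually_iff.1
    (NormedAddGroup.tendsto_nhds_zero.1 h0 (1 / 2) (by norm_num))
  obtain ⟨y, hy⟩ := NormedSpace.exists_lt_norm ℝ E (R + C)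
  refine ⟨y, fun x₁ x₂ h₁ h₂ => ?_⟩
  have hmem : ∀ x, Φ x = y → x ∈ Metric.closedBall y C := fun x hx => by
    rw [mem_closedBall_iff_norm, norm_sub_rev, ← hx]
    exact hC x
  have h := (convex_closedBall y C).norm_image_sub_le_of_norm_fderiv_le (𝕜 := ℝ) (C := 1 / 2)
    (f := fun x => Φ x - x)
    (fun z _ => ((hΦ.differentiable one_ne_zero).sub differentiable_id) z)
    (fun z hz => (hR ?_).le) (hmem x₁ h₁) (hmem x₂ h₂)
  · have e : Φ x₂ - x₂ - (Φ x₁ - x₁) = -(x₂ - x₁) := by rw [h₁, h₂]; abel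
    rw [e, norm_neg] at h
    have : ‖x₂ - x₁‖ = 0 := le_antisymm (by linarith) (norm_nonneg _)
    exact (sub_eq_zero.1 (norm_eq_zero.1 this)).symm
  · rw [mem_closedBall_iff_norm, norm_sub_rev] at hz
    rw [Set.mem_ofPred_eq]
    linarith [norm_sub_norm_le y z]

/-- The inverse of a `C^n` bijection with invertible derivatives. -/
theorem exists_inverse_of_isUnit_fderiv {n : ℕ} (hn : 1 ≤ n) (hΦ : ContDiff ℝ n Φ)
    (hu : ∀ x, IsUnit (fderiv ℝ Φ x)) (hb : Function.Bijective Φ) :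
    ∃ Ψ : E → E, Function.LeftInverse Ψ Φ ∧ Function.RightInverse Ψ Φ ∧ ContDiff ℝ n Ψ ∧
      ∀ y, HasFDerivAt Ψ (Ring.inverse (fderiv ℝ Φ (Ψ y))) y := by
  have : CompleteSpace E := FiniteDimensional.complete ℝ E
  have hΦ1 : ContDiff ℝ 1 Φ := hΦ.of_le (by exact_mod_cast hn)
  choose e _ hes he using fun x => hasStrictFDerivAt_equiv_of_isUnit hΦ1 (hu x)
  have hopen : IsOpenMap Φ := isOpenMap_of_hasStrictFDerivAt_equiv he
  let h : E ≃ₜ E := (Equiv.ofBijective Φ hb).toHomeomorphOfContinuousOpen hΦ.continuous hopen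
  refine ⟨h.symm, h.left_inv, h.right_inv,
    h.contDiff_symm (f₀' := e) (fun a => (he a).hasFDerivAt) hΦ, fun y => ?_⟩
  rw [← hes]
  exact HasFDerivAt.of_local_left_inverse h.symm.continuous.continuousAt
    (he (h.symm y)).hasFDerivAt (Eventually.of_forall h.right_inv)

end GlobalInverse

/-! ### The group structure -/

namespace HolderZero

universe u

variable {ι : Type*} {E F : Type u} [NormedAddCommGroup E] [NormedSpace ℝ E]
  [NormedAddCommGroup F] [NormedSpace ℝ F] {n : ℕ} {β : ℝ}

protected theorem contDiff (f : HolderZero E F n β) : ContDiff ℝ n f.toFun := f.2.1.1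

protected theorem differentiable (hn : 1 ≤ n) (f : HolderZero E F n β) :
    Differentiable ℝ f.toFun :=
  f.contDiff.differentiable (by exact_mod_cast Nat.one_le_iff_ne_zero.1 hn)

theorem coe_nnnorm_eq (f : HolderZero E F n β) : (‖f‖₊ : ℝ≥0∞) = eCHolderNorm n β f.toFun := by
  rw [← enorm_eq_nnnorm, ← ofReal_norm, norm_def]
  exact ENNReal.ofReal_toReal f.2.1.2.ne

theorem unifHolder_toFun_iff {f : ι → HolderZero E F n β} :
    UnifHolder n β (fun i => (f i).toFun) ↔ ∃ C : ℝ, ∀ i, ‖f i‖ ≤ C := by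
  constructor
  · rintro ⟨C, hC⟩
    refine ⟨C, fun i => ?_⟩
    have h := (hC i).2
    rw [← coe_nnnorm_eq] at h
    exact_mod_cast h
  · rintro ⟨C, hC⟩
    refine ⟨C.toNNReal, fun i => ⟨(f i).2.1.1, ?_⟩⟩
    rw [← coe_nnnorm_eq]
    have h : ‖f i‖₊ ≤ C.toNNReal := by
      rw [← NNReal.coe_le_coe, _root_.coe_nnnorm]
      exact (hC i).trans (Real.le_coe_toNNReal C)
    exact_mod_cast h

theorem norm_fderiv_le (hn : 1 ≤ n) (f : HolderZero E F n β) (x : E) :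
    ‖fderiv ℝ f.toFun x‖ ≤ ‖f‖ := by
  have h := ((eCHolderNorm_le_coe_iff f.toFun ‖f‖₊).1 (coe_nnnorm_eq f).ge).1 x 1 hn
  rwa [← norm_iteratedFDeriv_fderiv, norm_iteratedFDeriv_zero] at h

end HolderZero

theorem ContinuousLinearMap.det_mul {E : Type*} [NormedAddCommGroup E] [NormedSpace ℝ E]
    (A B : E →L[ℝ] E) : (A * B).det = A.det * B.det :=
  LinearMap.det_comp (A : E →ₗ[ℝ] E) (B : E →ₗ[ℝ] E)

theorem ContinuousLinearMap.det_one {E : Type*} [NormedAddCommGroup E] [NormedSpace ℝ E] :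
    (1 : E →L[ℝ] E).det = 1 :=
  LinearMap.det_id

theorem ContinuousLinearMap.isUnit_of_det_ne_zero {E : Type*} [NormedAddCommGroup E]
    [NormedSpace ℝ E] [FiniteDimensional ℝ E] {A : E →L[ℝ] E} (hA : A.det ≠ 0) : IsUnit A :=
  ⟨(ContinuousLinearEquiv.unitsEquiv ℝ E).symm (A.toContinuousLinearEquivOfDetNeZero hA), by
    ext x; rfl⟩

namespace HolderDiffeo

variable {n : ℕ} {β : ℝ} {d : ℕ}

theorem differentiable_sub_id (hn : 1 ≤ n) (Φ : HolderDiffeo n β d) :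
    Differentiable ℝ (fun x => Φ x - x) :=
  Φ.sub_id_mem.1.1.differentiable (by exact_mod_cast Nat.one_le_iff_ne_zero.1 hn)

protected theorem contDiff (Φ : HolderDiffeo n β d) : ContDiff ℝ n Φ.toFun := by
  have h := Φ.sub_id_mem.1.1.add contDiff_id
  simpa using h

theorem hasFDerivAt (hn : 1 ≤ n) (Φ : HolderDiffeo n β d) (x : EuclideanSpace ℝ (Fin d)) :
    HasFDerivAt Φ.toFun (fderiv ℝ Φ.toFun x) x :=
  (Φ.contDiff.differentiable (by exact_mod_cast Nat.one_le_iff_ne_zero.1 hn) x).hasFDerivAt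

theorem isUnit_fderiv (Φ : HolderDiffeo n β d) (x : EuclideanSpace ℝ (Fin d)) :
    IsUnit (fderiv ℝ Φ.toFun x) :=
  ContinuousLinearMap.isUnit_of_det_ne_zero (Φ.det_pos x).ne'

theorem exists_norm_sub_id_le (Φ : HolderDiffeo n β d) : ∃ C : ℝ, ∀ x, ‖Φ x - x‖ ≤ C := by
  obtain ⟨C, hC⟩ := Φ.sub_id_mem.1.unifHolder.exists_bound
  exact ⟨C, hC ()⟩

theorem exists_lipschitz (hn : 1 ≤ n) (Φ : HolderDiffeo n β d) :
    ∃ L : ℝ, ∀ x y, ‖Φ x - Φ y‖ ≤ L * ‖x - y‖ := by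
  obtain ⟨m, rfl⟩ : ∃ m, n = m + 1 := ⟨n - 1, by omega⟩
  obtain ⟨L, hL⟩ := Φ.sub_id_mem.1.unifHolder.exists_lipschitz
  exact ⟨L + 1, norm_sub_le_of_sub_id (hL ())⟩

theorem tendsto_cobounded (Φ : HolderDiffeo n β d) :
    Tendsto Φ.toFun (Bornology.cobounded _) (Bornology.cobounded _) := by
  obtain ⟨C, hC⟩ := Φ.exists_norm_sub_id_le
  exact tendsto_cobounded_of_sub_id_bounded hC

theorem tendsto_fderiv_sub_id (hn : 1 ≤ n) (Φ : HolderDiffeo n β d) :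
    Tendsto (fderiv ℝ (fun x => Φ x - x)) (Bornology.cobounded _) (𝓝 0) := by
  have h := Φ.sub_id_mem.2 1 hn
  rw [tendsto_zero_iff_norm_tendsto_zero] at h ⊢
  refine h.congr fun x => ?_
  rw [← norm_iteratedFDeriv_fderiv, norm_iteratedFDeriv_zero]

theorem fderiv_eq (hn : 1 ≤ n) (Φ : HolderDiffeo n β d) (x : EuclideanSpace ℝ (Fin d)) :
    fderiv ℝ Φ.toFun x = ContinuousLinearMap.id ℝ _ + fderiv ℝ Φ.chart.toFun x :=
  (differentiableAt_and_fderiv_eq_id_add (Φ.differentiable_sub_id hn) x).2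

/-- The range of `dΦ₀`, completed by its limit `Id` at infinity, is a compact subset of the open
set `{det > 0}`, so that a neighbourhood of it of fixed size stays in that set, and inversion is
bounded on this neighbourhood. -/
theorem exists_thickening (hn : 1 ≤ n) (Φ₀ : HolderDiffeo n β d) :
    ∃ δ > (0 : ℝ), ∃ C : ℝ, ∀ (M : EuclideanSpace ℝ (Fin d) →L[ℝ] EuclideanSpace ℝ (Fin d)) x,
      ‖M - fderiv ℝ Φ₀.toFun x‖ ≤ δ → 0 < M.det ∧ ‖Ring.inverse M‖ ≤ C := by
  set K := insert (ContinuousLinearMap.id ℝ (EuclideanSpace ℝ (Fin d)))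
    (Set.range (fderiv ℝ Φ₀.toFun)) with hK
  have hlim : Tendsto (fderiv ℝ Φ₀.toFun) (cocompact (EuclideanSpace ℝ (Fin d)))
      (𝓝 (ContinuousLinearMap.id ℝ _)) := by
    rw [← Metric.cobounded_eq_cocompact]
    have h := (Φ₀.tendsto_fderiv_sub_id hn).const_add (ContinuousLinearMap.id ℝ _)
    rw [add_zero] at h
    exact h.congr fun x => (Φ₀.fderiv_eq hn x).symm
  have hcont : Continuous (fderiv ℝ Φ₀.toFun) :=
    Φ₀.contDiff.continuous_fderiv (by exact_mod_cast Nat.one_le_iff_ne_zero.1 hn)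
  have hKc : IsCompact K := hlim.isCompact_insert_range_of_cocompact hcont
  have hU : IsOpen {M : EuclideanSpace ℝ (Fin d) →L[ℝ] EuclideanSpace ℝ (Fin d) | 0 < M.det} :=
    isOpen_lt continuous_const ContinuousLinearMap.continuous_det
  have hKU : K ⊆ {M | 0 < M.det} := by
    rintro M (rfl | ⟨x, rfl⟩)
    · exact zero_lt_one.trans_eq ContinuousLinearMap.det_one.symm
    · exact Φ₀.det_pos x
  obtain ⟨δ, hδ, hδU⟩ := hKc.exists_cthickening_subset_open hU hKU
  have : ProperSpace (EuclideanSpace ℝ (Fin d) →L[ℝ] EuclideanSpace ℝ (Fin d)) :=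
    FiniteDimensional.proper ℝ _
  obtain ⟨C, hC⟩ := (hKc.cthickening (r := δ)).exists_bound_of_continuousOn
    (f := Ring.inverse) fun M hM => by
      obtain ⟨u, rfl⟩ := ContinuousLinearMap.isUnit_of_det_ne_zero (ne_of_gt (hδU hM))
      exact (NormedRing.inverse_continuousAt u).continuousWithinAt
  refine ⟨δ, hδ, C, fun M x hM => ?_⟩
  have hmem : M ∈ Metric.cthickening δ K :=
    Metric.mem_cthickening_of_dist_le M (fderiv ℝ Φ₀.toFun x) δ K (Or.inr ⟨x, rfl⟩)
      (by rwa [dist_eq_norm])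
  exact ⟨hδU hmem, hC M hmem⟩

theorem bijective (hn : 1 ≤ n) (Φ : HolderDiffeo n β d) : Function.Bijective Φ.toFun := by
  obtain ⟨C, hC⟩ := Φ.exists_norm_sub_id_le
  exact bijective_of_isUnit_fderiv (Φ.contDiff.of_le (by exact_mod_cast hn)) Φ.isUnit_fderiv hC
    (Φ.tendsto_fderiv_sub_id hn)

/-- The identity. -/
def refl (hβ0 : 0 < β) (hβ1 : β ≤ 1) : HolderDiffeo n β d where
  toFun := id
  sub_id_mem := by
    refine (memHolderZero_iff_tendsto hβ0 hβ1).2 ⟨?_, ?_⟩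
    · simpa using (unifHolder_const (ι := Unit) hβ0 0).memHolderB ()
    · simpa using tendsto_const_nhds
  det_pos x := by
    rw [fderiv_id]
    exact zero_lt_one.trans_eq ContinuousLinearMap.det_one.symm

/-- Composition, with `Φ ∘ Ψ - Id = (Φ - Id) ∘ Ψ + (Ψ - Id)`. -/
def comp (hn : 1 ≤ n) (hβ0 : 0 < β) (hβ1 : β ≤ 1) (Φ Ψ : HolderDiffeo n β d) :
    HolderDiffeo n β d where
  toFun := Φ.toFun ∘ Ψ.toFun
  sub_id_mem := by
    have e : (fun x => (Φ.toFun ∘ Ψ.toFun) x - x) =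
        fun x => (Φ (Ψ x) - Ψ x) + (Ψ x - x) := by
      funext x
      simp
    obtain ⟨L, hL⟩ := Ψ.exists_lipschitz hn
    rw [e]
    refine (memHolderZero_iff_tendsto hβ0 hβ1).2 ⟨?_, ?_⟩
    · exact ((Φ.sub_id_mem.1.unifHolder.comp_of_sub_id hβ0 hβ1 (fun _ => hL)
        Ψ.sub_id_mem.1.unifHolder).add Ψ.sub_id_mem.1.unifHolder).memHolderB ()
    · have h1 := ((memHolderZero_iff_tendsto hβ0 hβ1).1 Φ.sub_id_mem).2.comp Ψ.tendsto_cobounded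
      have h2 := ((memHolderZero_iff_tendsto hβ0 hβ1).1 Ψ.sub_id_mem).2
      simpa using h1.add h2
  det_pos x := by
    rw [((Φ.hasFDerivAt hn (Ψ x)).comp x (Ψ.hasFDerivAt hn x)).fderiv]
    exact (mul_pos (Φ.det_pos _) (Ψ.det_pos x)).trans_eq (ContinuousLinearMap.det_mul _ _).symm

/-- The inverse maps of a family that is bounded in the chart, and whose derivatives have
uniformly bounded inverses, form a bounded family. -/
theorem unifHolder_inverse_sub_id {ι : Type*} (hn : 1 ≤ n) (hβ0 : 0 < β) (hβ1 : β ≤ 1)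
    {Φ : ι → HolderDiffeo n β d}
    {Ψ : ι → EuclideanSpace ℝ (Fin d) → EuclideanSpace ℝ (Fin d)} {C : ℝ}
    (hΦ : UnifHolder n β (fun i x => Φ i x - x))
    (hC : ∀ i x, ‖Ring.inverse (fderiv ℝ (Φ i).toFun x)‖ ≤ C)
    (hl : ∀ i, Function.LeftInverse (Ψ i) (Φ i).toFun) :
    UnifHolder n β (fun i y => Ψ i y - y) := by
  have key : ∀ i, Function.RightInverse (Ψ i) (Φ i).toFun ∧
      ∀ y, HasFDerivAt (Ψ i) (Ring.inverse (fderiv ℝ (Φ i).toFun (Ψ i y))) y := by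
    intro i
    obtain ⟨Ψ', hl', hr', -, hd'⟩ := exists_inverse_of_isUnit_fderiv hn (Φ i).contDiff
      (Φ i).isUnit_fderiv ((Φ i).bijective hn)
    have : Ψ i = Ψ' := by
      funext y
      obtain ⟨x, rfl⟩ := ((Φ i).bijective hn).2 y
      rw [hl i, hl']
    rw [this]
    exact ⟨hr', hd'⟩
  obtain ⟨m, rfl⟩ : ∃ m, n = m + 1 := ⟨n - 1, by omega⟩
  exact hΦ.inverse_sub_id hβ0 hβ1 (fun i x => (Φ i).isUnit_fderiv x) hC
    (fun i => (key i).1) fun i => (key i).2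

/-- The inverse map of an element of `D^{n,β}(ℝ^d)` is again one: it decays at infinity because
`Φ⁻¹ - Id = -(Φ - Id) ∘ Φ⁻¹`. -/
theorem exists_inverse (hn : 1 ≤ n) (hβ0 : 0 < β) (hβ1 : β ≤ 1) (Φ : HolderDiffeo n β d) :
    ∃ Ψ : HolderDiffeo n β d, Function.LeftInverse Ψ.toFun Φ.toFun ∧
      Function.RightInverse Ψ.toFun Φ.toFun := by
  obtain ⟨Ψ, hl, hr, -, hd⟩ := exists_inverse_of_isUnit_fderiv hn Φ.contDiff Φ.isUnit_fderiv
    (Φ.bijective hn)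
  obtain ⟨δ, hδ, C, hC⟩ := Φ.exists_thickening hn
  have hb : UnifHolder n β (fun (_ : Unit) y => Ψ y - y) :=
    unifHolder_inverse_sub_id hn hβ0 hβ1 (Φ := fun _ => Φ) Φ.sub_id_mem.1.unifHolder
      (fun _ x => (hC _ x (by rw [sub_self, norm_zero]; exact hδ.le)).2) fun _ => hl
  obtain ⟨D, hD⟩ := hb.exists_bound
  refine ⟨⟨Ψ, (memHolderZero_iff_tendsto hβ0 hβ1).2 ⟨hb.memHolderB (), ?_⟩, fun y => ?_⟩, hl, hr⟩
  · have h := (((memHolderZero_iff_tendsto hβ0 hβ1).1 Φ.sub_id_mem).2.comp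
      (tendsto_cobounded_of_sub_id_bounded (hD ()))).neg
    rw [neg_zero] at h
    refine h.congr fun y => ?_
    simp [hr y]
  · rw [(hd y).fderiv]
    have h : (fderiv ℝ Φ.toFun (Ψ y)).det * (Ring.inverse (fderiv ℝ Φ.toFun (Ψ y))).det = 1 := by
      rw [← ContinuousLinearMap.det_mul, Ring.mul_inverse_cancel _ (Φ.isUnit_fderiv _),
        ContinuousLinearMap.det_one]
    exact pos_of_mul_pos_right (h ▸ zero_lt_one) (Φ.det_pos _).le

/-- The group structure of `D^{n,β}(ℝ^d)`, with composition as multiplication. -/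
@[reducible]
noncomputable def group (hn : 1 ≤ n) (hβ0 : 0 < β) (hβ1 : β ≤ 1) : Group (HolderDiffeo n β d) :=
  letI : Mul (HolderDiffeo n β d) := ⟨comp hn hβ0 hβ1⟩
  letI : One (HolderDiffeo n β d) := ⟨refl hβ0 hβ1⟩
  letI : Inv (HolderDiffeo n β d) := ⟨fun Φ => (exists_inverse hn hβ0 hβ1 Φ).choose⟩
  Group.ofLeftAxioms (fun _ _ _ => rfl) (fun _ => rfl) fun Φ =>
    HolderDiffeo.ext (funext (exists_inverse hn hβ0 hβ1 Φ).choose_spec.1)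

/-! ### Openness, and local boundedness of inversion -/

/-- The element `Id + f` of `D^{n,β}(ℝ^d)`. -/
noncomputable def ofHolderZero
    (f : HolderZero (EuclideanSpace ℝ (Fin d)) (EuclideanSpace ℝ (Fin d)) n β)
    (hf : ∀ x, 0 < (fderiv ℝ (fun x => x + f.toFun x) x).det) : HolderDiffeo n β d where
  toFun x := x + f.toFun x
  sub_id_mem := by
    simp only [add_sub_cancel_left]
    exact f.2
  det_pos := hf

theorem chart_ofHolderZero
    {f : HolderZero (EuclideanSpace ℝ (Fin d)) (EuclideanSpace ℝ (Fin d)) n β}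
    (hf : ∀ x, 0 < (fderiv ℝ (fun x => x + f.toFun x) x).det) : (ofHolderZero f hf).chart = f :=
  Subtype.ext (funext fun x => add_sub_cancel_left x (f.toFun x))

/-- A whole ball around `Φ₀` in the chart consists of elements of `D^{n,β}(ℝ^d)`, with uniformly
bounded inverses of the derivatives. -/
theorem exists_ball (hn : 1 ≤ n) (Φ₀ : HolderDiffeo n β d) :
    ∃ δ > (0 : ℝ), Metric.ball Φ₀.chart δ ⊆ Set.range (chart (n := n) (β := β) (d := d)) ∧
      ∃ C : ℝ, ∀ Φ : HolderDiffeo n β d, Φ.chart ∈ Metric.ball Φ₀.chart δ →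
        ∀ x, ‖Ring.inverse (fderiv ℝ Φ.toFun x)‖ ≤ C := by
  obtain ⟨δ, hδ, C, hC⟩ := Φ₀.exists_thickening hn
  have key : ∀ f ∈ Metric.ball Φ₀.chart δ, ∀ x,
      ‖(ContinuousLinearMap.id ℝ _ + fderiv ℝ f.toFun x) - fderiv ℝ Φ₀.toFun x‖ ≤ δ := by
    intro f hf x
    rw [Φ₀.fderiv_eq hn, add_sub_add_left_eq_sub,
      ← fderiv_sub (f.differentiable hn x) (Φ₀.chart.differentiable hn x)]
    rw [mem_ball_iff_norm] at hf
    exact (HolderZero.norm_fderiv_le hn (f - Φ₀.chart) x).trans hf.le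
  refine ⟨δ, hδ, fun f hf => ?_, C, fun Φ hΦ x => ?_⟩
  · refine ⟨ofHolderZero f fun x => ?_, chart_ofHolderZero _⟩
    have h : fderiv ℝ (fun x => x + f.toFun x) x =
        ContinuousLinearMap.id ℝ _ + fderiv ℝ f.toFun x :=
      ((hasFDerivAt_id x).add (f.differentiable hn x).hasFDerivAt).fderiv
    rw [h]
    exact (hC _ x (key f hf x)).1
  · rw [Φ.fderiv_eq hn]
    exact (hC _ x (key _ hΦ x)).2

theorem exists_norm_inverse_chart_le {ι : Type*} (hn : 1 ≤ n) (hβ0 : 0 < β) (hβ1 : β ≤ 1)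
    {Φ Ψ : ι → HolderDiffeo n β d} {C D : ℝ} (hD : ∀ i, ‖(Φ i).chart‖ ≤ D)
    (hC : ∀ i x, ‖Ring.inverse (fderiv ℝ (Φ i).toFun x)‖ ≤ C)
    (hl : ∀ i, Function.LeftInverse (Ψ i).toFun (Φ i).toFun) :
    ∃ D' : ℝ, ∀ i, ‖(Ψ i).chart‖ ≤ D' :=
  HolderZero.unifHolder_toFun_iff.1
    (unifHolder_inverse_sub_id hn hβ0 hβ1
      (HolderZero.unifHolder_toFun_iff.2 ⟨D, hD⟩ : UnifHolder n β fun i => (Φ i).chart.toFun)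
      hC hl :
      UnifHolder n β fun i => (Ψ i).chart.toFun)

end HolderDiffeo

/-! ### A function whose top derivative has a cusp -/

section Cusp

universe u

variable {n : ℕ} {β : ℝ}

theorem HasCompactSupport.unifHolder {E F : Type u} [NormedAddCommGroup E] [NormedSpace ℝ E]
    [NormedAddCommGroup F] [NormedSpace ℝ F] (hβ0 : 0 < β) (hβ1 : β ≤ 1) {f : E → F}
    (hs : HasCompactSupport f) (hf : ContDiff ℝ (n + 1 : ℕ) f) :
    UnifHolder n β (fun _ : Unit => f) := by
  induction n generalizing F with
  | zero =>
    obtain ⟨C, hC⟩ := hf.continuous.bounded_above_of_compact_support hs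
    obtain ⟨D, hD⟩ := (hf.continuous_fderiv (by simp)).bounded_above_of_compact_support
      (hs.fderiv ℝ)
    exact unifHolder_zero_of_lipschitz hβ0 hβ1 (fun _ => hC)
      fun _ => norm_sub_le_of_norm_fderiv_le (hf.differentiable (by simp)) hD
  | succ n ih =>
    obtain ⟨C, hC⟩ := hf.continuous.bounded_above_of_compact_support hs
    exact unifHolder_succ_iff.2
      ⟨fun _ => hf.differentiable (by exact_mod_cast Nat.succ_ne_zero (n + 1)), ⟨C, fun _ => hC⟩,
        ih (hs.fderiv ℝ) (hf.fderiv_right (by norm_cast))⟩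

/-- Repeated integration of a periodic function. Subtracting the mean before each integration
keeps the primitives periodic, hence bounded; it changes the `n`-th derivative by a constant
only. -/
theorem exists_periodic_iteratedDeriv_eq (hβ0 : 0 < β) (hβ1 : β ≤ 1) {h : ℝ → ℝ} {T : ℝ}
    (hT : 0 < T) (hper : Function.Periodic h T) (hh : UnifHolder 0 β (fun _ : Unit => h)) (n : ℕ) :
    ∃ (g : ℝ → ℝ) (c : ℝ), Function.Periodic g T ∧ UnifHolder n β (fun _ : Unit => g) ∧
      ∀ t, iteratedDeriv n g t = h t - c := by
  induction n with
  | zero => exact ⟨h, 0, hper, hh, fun t => by simp⟩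
  | succ n ih =>
    obtain ⟨g, c, hg, hgn, hgd⟩ := ih
    have hgC : ContDiff ℝ n g := (hgn.memHolderB ()).1
    set a : ℝ := (∫ t in (0 : ℝ)..T, g t) / T with ha
    have hcont : Continuous fun t => g t - a := hgC.continuous.sub continuous_const
    have hint : ∀ s t, IntervalIntegrable (fun t => g t - a) MeasureTheory.volume s t := fun s t =>
      hcont.intervalIntegrable s t
    have hper' : Function.Periodic (fun t => g t - a) T := fun t => by
      change g (t + T) - a = g t - a
      rw [hg t]
    have hmean : ∫ t in (0 : ℝ)..T, (g t - a) = 0 := by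
      rw [intervalIntegral.integral_sub (hgC.continuous.intervalIntegrable _ _)
        (continuous_const.intervalIntegrable _ _), intervalIntegral.integral_const, ha, sub_zero,
        smul_eq_mul, mul_div_cancel₀ _ hT.ne', sub_self]
    set G : ℝ → ℝ := fun u => ∫ t in (0 : ℝ)..u, (g t - a) with hG
    have hder : ∀ t, HasDerivAt G (g t - a) t := fun t =>
      (hcont.integral_hasStrictDerivAt 0 t).hasDerivAt
    have hGper : Function.Periodic G T := fun t => by
      have h1 := intervalIntegral.integral_add_adjacent_intervals (hint 0 t) (hint t (t + T))
      have h2 := hper'.intervalIntegral_add_eq t 0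
      rw [zero_add, hmean] at h2
      rw [h2, add_zero] at h1
      exact h1.symm
    have hderiv : deriv G = fun t => g t - a := funext fun t => (hder t).deriv
    have hGdiff : Differentiable ℝ G := fun t => (hder t).differentiableAt
    obtain ⟨D, hD⟩ := (hGper.isBounded_of_continuous hT.ne' hGdiff.continuous).exists_norm_le
    -- The mean contributes to the `n`-th derivative of `g - a` only when `n = 0`.
    refine ⟨G, c + iteratedDeriv n (fun _ => a) (0 : ℝ), hGper, unifHolder_succ_iff.2
      ⟨fun _ => hGdiff, ⟨D, fun _ t => hD _ ⟨t, rfl⟩⟩, ?_⟩, fun t => ?_⟩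
    · have e : (fun _ : Unit => fderiv ℝ G) = fun _ t =>
          ContinuousLinearMap.smulRightL ℝ ℝ ℝ (1 : ℝ →L[ℝ] ℝ) (g t - a) := by
        funext _ t
        rw [(hder t).hasFDerivAt.fderiv]
        ext
        simp
      rw [e]
      exact UnifHolder.bilinear hβ0 hβ1 _ (unifHolder_const hβ0 _)
        (hgn.sub (unifHolder_const hβ0 a))
    · rw [iteratedDeriv_succ', hderiv, iteratedDeriv_fun_sub hgC.contDiffAt contDiffAt_const, hgd,
        iteratedDeriv_const, iteratedDeriv_const, sub_sub]

theorem abs_rpow_sub_rpow_le (hβ0 : 0 < β) (hβ1 : β ≤ 1) {a b : ℝ} (ha : 0 ≤ a) (hb : 0 ≤ b) :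
    |a ^ β - b ^ β| ≤ |a - b| ^ β := by
  have key : ∀ {a b : ℝ}, 0 ≤ a → 0 ≤ b → a ^ β - b ^ β ≤ |a - b| ^ β := by
    intro a b ha hb
    have h1 : a ^ β ≤ (|a - b| + b) ^ β :=
      Real.rpow_le_rpow ha (by linarith [le_abs_self (a - b)]) hβ0.le
    linarith [Real.rpow_add_le_add_rpow (abs_nonneg (a - b)) hb hβ0.le hβ1]
  refine abs_le.2 ⟨?_, key ha hb⟩
  have := key hb ha
  rw [abs_sub_comm] at this
  linarith

theorem unifHolder_abs_sin_rpow (hβ0 : 0 < β) (hβ1 : β ≤ 1) :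
    UnifHolder 0 β (fun (_ : Unit) t => |Real.sin t| ^ β) := by
  refine (unifHolder_zero_iff hβ0).2 ⟨1, fun _ => ⟨fun t => ?_, fun s t => ?_⟩⟩
  · rw [Real.norm_of_nonneg (by positivity)]
    exact Real.rpow_le_one (abs_nonneg _) (Real.abs_sin_le_one t) hβ0.le
  · rw [one_mul]
    refine (abs_rpow_sub_rpow_le hβ0 hβ1 (abs_nonneg _) (abs_nonneg _)).trans ?_
    refine Real.rpow_le_rpow (abs_nonneg _) ?_ hβ0.le
    exact (abs_abs_sub_abs_le _ _).trans (Real.abs_sin_sub_sin_le s t)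

variable {E : Type} [NormedAddCommGroup E] [InnerProductSpace ℝ E]

/-- A bounded function of one coordinate, times a fixed vector, can be cut off to an element of
`C^{n,β}_0` without change near the origin. -/
theorem exists_holderZero_eq_smul [FiniteDimensional ℝ E] (hβ0 : 0 < β) (hβ1 : β ≤ 1)
    {g : ℝ → ℝ} (hg : UnifHolder n β (fun _ : Unit => g)) (e : E) :
    ∃ ψ : HolderZero E E n β, ∀ x, ‖x‖ ≤ 1 → ψ.toFun x = g (inner ℝ e x) • e := by
  let χ : ContDiffBump (0 : E) := default
  have hχ : UnifHolder n β (fun (_ : Unit) x => χ x) :=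
    χ.hasCompactSupport.unifHolder hβ0 hβ1 χ.contDiff
  have hge : UnifHolder n β (fun (_ : Unit) x => g (innerSL ℝ e x)) := by
    refine hg.comp hβ0 hβ1 (φ := fun _ x => innerSL ℝ e x) (L := ‖innerSL ℝ e‖) (fun _ x y => ?_)
      fun m _ => ⟨fun _ => (innerSL ℝ e).differentiable, ?_⟩
    · rw [← map_sub]
      exact (innerSL ℝ e).le_opNorm _
    · have h : (fun _ : Unit => fderiv ℝ (fun x => innerSL ℝ e x)) =
          fun _ _ => innerSL ℝ e := by
        funext _ x
        exact (innerSL ℝ e).fderiv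
      rw [h]
      exact unifHolder_const hβ0 _
  have h1 := UnifHolder.bilinear hβ0 hβ1 (ContinuousLinearMap.lsmul ℝ ℝ) hχ
    (UnifHolder.bilinear hβ0 hβ1 (ContinuousLinearMap.lsmul ℝ ℝ) hge
      (unifHolder_const hβ0 (e : E)))
  refine ⟨⟨fun x => χ x • (g (inner ℝ e x) • e), (memHolderZero_iff_tendsto hβ0 hβ1).2
    ⟨h1.memHolderB (), ?_⟩⟩, fun x hx => ?_⟩
  · rw [Metric.cobounded_eq_cocompact]
    exact (χ.hasCompactSupport.smul_right
      (f' := fun x => g (inner ℝ e x) • e)).is_zero_at_infty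
  · change χ x • (g (inner ℝ e x) • e) = _
    rw [χ.one_of_mem_closedBall (by rw [mem_closedBall_zero_iff]; exact hx), one_smul]

/-- The `n`-th derivatives along a line of unit speed obey the Hölder bound. -/
theorem HolderZero.norm_iteratedDeriv_line_sub_le (f : HolderZero E E n β) {e : E} (he : ‖e‖ = 1)
    (s t : ℝ) : ‖iteratedDeriv n (fun t : ℝ => f.toFun (t • e)) s -
      iteratedDeriv n (fun t : ℝ => f.toFun (t • e)) t‖ ≤ ‖f‖ * |s - t| ^ β := by
  have key : ∀ t : ℝ, iteratedDeriv n (fun t : ℝ => f.toFun (t • e)) t =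
      iteratedFDeriv ℝ n f.toFun (t • e) (fun _ => e) := by
    intro t
    have h := (ContinuousLinearMap.toSpanSingleton ℝ e).iteratedFDeriv_comp_right f.contDiff t
      le_rfl
    have h' := congrArg (fun A => A fun _ : Fin n => (1 : ℝ)) h
    simpa [iteratedDeriv_eq_iteratedFDeriv, Function.comp_def] using h'
  rw [key, key, ← sub_apply]
  refine (ContinuousMultilinearMap.le_opNorm _ _).trans ?_
  have h := ((eCHolderNorm_le_coe_iff f.toFun ‖f‖₊).1 f.coe_nnnorm_eq.ge).2 (s • e) (t • e)
  rw [← sub_smul, norm_smul, he, mul_one, Real.norm_eq_abs] at h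
  simpa [he] using h

/-- If `f` is, near the origin of the line `ℝ e`, the increment `c (g(t + ε) - g(t)) e` up to a
constant, then the second difference of the `n`-th derivative of `g` bounds the norm of `f` from
below. -/
theorem HolderZero.le_norm_of_eq_increment (hn : 1 ≤ n) (f : HolderZero E E n β) {e : E}
    (he : ‖e‖ = 1) {g : ℝ → ℝ} (hg : ContDiff ℝ n g) {ε c r b : ℝ} (hε : 0 < ε) (hεr : ε < r)
    (hf : ∀ t : ℝ, |t| < r → f.toFun (t • e) = (b + c * (g (t + ε) - g t)) • e) :
    |c * (iteratedDeriv n g ε + iteratedDeriv n g (-ε) - 2 * iteratedDeriv n g 0)| ≤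
      ‖f‖ * ε ^ β := by
  have key : ∀ t : ℝ, |t| < r → iteratedDeriv n (fun t : ℝ => f.toFun (t • e)) t =
      (c * (iteratedDeriv n g (t + ε) - iteratedDeriv n g t)) • e := by
    intro t ht
    have hev : (fun t : ℝ => f.toFun (t • e)) =ᶠ[𝓝 t]
        fun t => (b + c * (g (t + ε) - g t)) • e := by
      filter_upwards [(isOpen_lt continuous_abs continuous_const).mem_nhds ht] with s hs
      exact hf s hs
    have hshift : ContDiff ℝ n fun t => g (t + ε) := hg.comp (contDiff_id.add contDiff_const)
    rw [hev.iteratedDeriv_eq, iteratedDeriv_smul_const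
      (contDiff_const.add (contDiff_const.mul (hshift.sub hg))).contDiffAt,
      iteratedDeriv_const_add hn, iteratedDeriv_const_mul_field,
      iteratedDeriv_fun_sub hshift.contDiffAt hg.contDiffAt, iteratedDeriv_comp_add_const]
  have h := f.norm_iteratedDeriv_line_sub_le he 0 (-ε)
  rw [key 0 (by simpa using hε.trans hεr), key (-ε) (by rwa [abs_neg, abs_of_pos hε]), ← sub_smul,
    norm_smul, he, mul_one, zero_add, neg_add_cancel, zero_sub, neg_neg, abs_of_pos hε,
    Real.norm_eq_abs] at h
  refine le_of_eq_of_le ?_ h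
  congr 1
  ring

end Cusp

/-! ### Discontinuity of left translations -/

namespace HolderDiffeo

variable {n : ℕ} {β : ℝ} {d : ℕ}

theorem chart_refl (hβ0 : 0 < β) (hβ1 : β ≤ 1) :
    (refl hβ0 hβ1 : HolderDiffeo n β d).chart = 0 :=
  Subtype.ext (funext fun x => sub_self x)

theorem exists_comp_not_continuous (hn : 1 ≤ n) (hβ0 : 0 < β) (hβ1 : β ≤ 1) (hd : 1 ≤ d) :
    ∃ Ψ : HolderDiffeo n β d, ¬ Continuous fun Φ => comp hn hβ0 hβ1 Ψ Φ := by
  obtain ⟨e, he⟩ : ∃ e : EuclideanSpace ℝ (Fin d), ‖e‖ = 1 :=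
    ⟨EuclideanSpace.single ⟨0, hd⟩ 1, by simp⟩
  have hee : ∀ t : ℝ, inner ℝ e (t • e) = t := fun t => by
    rw [inner_smul_right, real_inner_self_eq_norm_sq, he, one_pow, mul_one]
  have hte : ∀ t : ℝ, ‖t • e‖ = |t| := fun t => by rw [norm_smul, he, mul_one, Real.norm_eq_abs]
  -- `g` is bounded with `n`-th derivative `|sin t| ^ β` up to a constant.
  obtain ⟨g, a, -, hgH, hg⟩ := exists_periodic_iteratedDeriv_eq hβ0 hβ1 Real.two_pi_pos
    (fun t => by simp only [Real.sin_add_two_pi]) (unifHolder_abs_sin_rpow hβ0 hβ1) n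
  obtain ⟨ψ, hψ⟩ := exists_holderZero_eq_smul hβ0 hβ1 hgH e
  -- `η` equals `e` near the origin, so that `Id + ε η` is a translation there.
  obtain ⟨η, hη⟩ := exists_holderZero_eq_smul (n := n) hβ0 hβ1 (unifHolder_const hβ0 1) e
  obtain ⟨δ, hδ, hball, -⟩ := exists_ball hn (refl hβ0 hβ1 : HolderDiffeo n β d)
  rw [chart_refl] at hball
  have hsmall : ∀ (f : HolderZero (EuclideanSpace ℝ (Fin d)) (EuclideanSpace ℝ (Fin d)) n β)
      {δ : ℝ}, 0 < δ → ∀ᶠ c : ℝ in 𝓝[>] 0, ‖c • f‖ < δ := by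
    intro f δ hδ
    have h : Tendsto (fun c : ℝ => ‖c • f‖) (𝓝 0) (𝓝 ‖(0 : ℝ) • f‖) :=
      (continuous_id.smul continuous_const).norm.tendsto 0
    rw [zero_smul, norm_zero] at h
    exact (h.mono_left nhdsWithin_le_nhds).eventually_lt_const hδ
  obtain ⟨c, hcδ, hc⟩ := ((hsmall ψ hδ).and self_mem_nhdsWithin).exists
  replace hc : 0 < c := hc
  obtain ⟨Ψ, hΨ⟩ := hball (mem_ball_zero_iff.2 hcδ)
  have hΨval : ∀ x, Ψ x = x + c • ψ.toFun x := fun x =>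
    (eq_add_of_sub_eq' (congrFun (congrArg HolderZero.toFun hΨ) x))
  refine ⟨Ψ, fun hcont => ?_⟩
  -- `2 / π` is the constant in `sin ε ≥ (2 / π) ε`.
  have hκ : 0 < c * (2 / Real.pi) ^ β := mul_pos hc (by positivity)
  obtain ⟨δ', hδ', hΨcont⟩ := Metric.continuousAt_iff.1
    (hcont.continuousAt (x := refl hβ0 hβ1)) _ hκ
  obtain ⟨ε, ⟨hε₁, hε₂⟩, hε₀⟩ := (((hsmall η (lt_min hδ hδ')).and
    (nhdsWithin_le_nhds (eventually_lt_nhds (show (0 : ℝ) < 1 / 2 by norm_num)))).and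
      self_mem_nhdsWithin).exists
  replace hε₀ : 0 < ε := hε₀
  obtain ⟨Φ, hΦ⟩ := hball (mem_ball_zero_iff.2 (hε₁.trans_le (min_le_left _ _)))
  have hΦval : ∀ x, Φ x = x + ε • η.toFun x := fun x =>
    (eq_add_of_sub_eq' (congrFun (congrArg HolderZero.toFun hΦ) x))
  have hdist : dist Φ (refl hβ0 hβ1) < δ' := by
    rw [dist_def, chart_refl, sub_zero, hΦ]
    exact hε₁.trans_le (min_le_right _ _)
  have hlt := hΨcont hdist
  rw [dist_def] at hlt
  set f := chart (comp hn hβ0 hβ1 Ψ Φ) - chart (comp hn hβ0 hβ1 Ψ (refl hβ0 hβ1)) with hf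
  have hfval : ∀ x, f.toFun x = Ψ (Φ x) - Ψ x := fun x => sub_sub_sub_cancel_right _ _ _
  have hline : ∀ t : ℝ, |t| < 1 / 2 → f.toFun (t • e) = (ε + c * (g (t + ε) - g t)) • e := by
    intro t ht
    have h1 : |t + ε| ≤ 1 := by
      rw [abs_lt] at ht
      rw [abs_le]
      constructor <;> linarith
    have h2 : Φ (t • e) = (t + ε) • e := by
      rw [hΦval, hη _ (by rw [hte]; linarith), one_smul, add_smul]
    rw [hfval, h2, hΨval, hΨval, hψ _ (by rw [hte]; exact h1), hψ _ (by rw [hte]; linarith),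
      hee, hee]
    module
  have hlow := f.le_norm_of_eq_increment hn he (hgH.memHolderB ()).1 hε₀ hε₂ hline
  have hsin : 2 / Real.pi * ε ≤ Real.sin ε :=
    Real.mul_le_sin hε₀.le (by linarith [Real.pi_gt_three])
  have hsin0 : 0 ≤ Real.sin ε := le_trans (by positivity) hsin
  have hval : c * (iteratedDeriv n g ε + iteratedDeriv n g (-ε) - 2 * iteratedDeriv n g 0) =
      2 * (c * Real.sin ε ^ β) := by
    rw [hg, hg, hg, Real.sin_neg, abs_neg, Real.sin_zero, abs_zero, Real.zero_rpow hβ0.ne',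
      abs_of_nonneg hsin0]
    ring
  have hεβ : 0 < ε ^ β := Real.rpow_pos_of_pos hε₀ β
  have hpow : (2 / Real.pi) ^ β * ε ^ β ≤ Real.sin ε ^ β := by
    rw [← Real.mul_rpow (by positivity) hε₀.le]
    exact Real.rpow_le_rpow (by positivity) hsin hβ0.le
  rw [hval, abs_of_nonneg (by positivity)] at hlow
  have h3 : c * (2 / Real.pi) ^ β * ε ^ β ≤ c * Real.sin ε ^ β := by
    rw [mul_assoc]
    gcongr
  have h4 : ‖f‖ * ε ^ β < c * (2 / Real.pi) ^ β * ε ^ β := by gcongr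
  have h5 : 0 < c * (2 / Real.pi) ^ β * ε ^ β := by positivity
  linarith

end HolderDiffeo

theorem mainTheorem3 (n : ℕ) (hn : 1 ≤ n) (β : ℝ) (hβ0 : 0 < β) (hβ1 : β ≤ 1) (d : ℕ) :
    -- a group structure whose multiplication is composition
    ∃ _ : Group (HolderDiffeo n β d),
      (∀ Φ Ψ : HolderDiffeo n β d, (Φ * Ψ).toFun = Φ.toFun ∘ Ψ.toFun) ∧
      (1 : HolderDiffeo n β d).toFun = id ∧
      -- the elements are `C^n`-diffeomorphisms, with the group inverse as inverse map
      (∀ Φ : HolderDiffeo n β d,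
        Function.LeftInverse (Φ⁻¹).toFun Φ.toFun ∧ Function.RightInverse (Φ⁻¹).toFun Φ.toFun ∧
        ContDiff ℝ n Φ.toFun ∧ ContDiff ℝ n (Φ⁻¹).toFun) ∧
      -- the image of the chart is open, and inversion in the chart is locally bounded
      (∀ Φ₀ : HolderDiffeo n β d, ∃ δ > (0 : ℝ),
        Metric.ball Φ₀.chart δ ⊆ Set.range (HolderDiffeo.chart (n := n) (β := β) (d := d)) ∧
        Bornology.IsBounded
          {τ | ∃ Φ : HolderDiffeo n β d, Φ.chart ∈ Metric.ball Φ₀.chart δ ∧ τ = (Φ⁻¹).chart}) ∧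
      -- there are discontinuous left translations
      (1 ≤ d → ∃ Ψ : HolderDiffeo n β d, ¬ Continuous (fun Φ : HolderDiffeo n β d => Ψ * Φ)) := by
  let _ := HolderDiffeo.group (d := d) hn hβ0 hβ1
  have hinv := fun Φ : HolderDiffeo n β d => (Φ.exists_inverse hn hβ0 hβ1).choose_spec
  refine ⟨HolderDiffeo.group hn hβ0 hβ1, fun _ _ => rfl, rfl,
    fun Φ => ⟨(hinv Φ).1, (hinv Φ).2, Φ.contDiff, (Φ⁻¹).contDiff⟩, fun Φ₀ => ?_,
    fun hd => HolderDiffeo.exists_comp_not_continuous hn hβ0 hβ1 hd⟩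
  obtain ⟨δ, hδ, hball, C, hC⟩ := Φ₀.exists_ball hn
  refine ⟨δ, hδ, hball, ?_⟩
  obtain ⟨D, hD⟩ := HolderDiffeo.exists_norm_inverse_chart_le hn hβ0 hβ1
    (Φ := fun Φ : {Φ : HolderDiffeo n β d // Φ.chart ∈ Metric.ball Φ₀.chart δ} => Φ.1)
    (Ψ := fun Φ => Φ.1⁻¹) (fun Φ => (norm_lt_of_mem_ball Φ.2).le) (fun Φ => hC Φ.1 Φ.2)
    fun Φ => (hinv Φ.1).1
  refine isBounded_iff_forall_norm_le.2 ⟨D, ?_⟩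
  rintro _ ⟨Φ, hΦ, rfl⟩
  exact hD ⟨Φ, hΦ⟩
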